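/- Let $X$ be a nonempty countable set and let $b : X\times X\to[0,\infty)$ satisfy $b(x,x)=0$, $b(x,y)=b(y,x)$ and $\sum_{z\in X} b(x,z)<\infty$ for all $x,y\in X$. Let $\mu : X\to(0,\infty)$ and $V : X\to\mathbb R$. Let $\ell^2(X,\mu)$ be the complex Hilbert space of all $f:X\to\mathbb C$ with $\|f\|^2=\sum_{x}|f(x)|^2\mu(x)<\infty$, and let $C_c(X)$ be the space of finitely supported functions $X\to\mathbb C$. Let $\mathcal F=\{f:X\to\mathbb C \mid \sum_{y} b(x,y)|f(y)|<\infty \text{ for all } x\in X\}$ and, for $f\in\mathcal F$, $$\mathcal H f(x)=\frac1{\mu(x)}\sum_{y\in X} b(x,y)\,(f(x)-f(y))+V(x)f(x),\qquad x\in X.$$ For $\varphi\in C_c(X)$ let $$\mathcal Q^c_V(\varphi)=\frac12\sum_{x,y\in X} b(x,y)|\varphi(x)-\varphi(y)|^2+\sum_{x\in X}V(x)|\varphi(x)|^2\mu(x).$$ A realization of $\mathcal H$ is a self-adjoint operator $H$ on $\ell^2(X,\mu)$ that is bounded from below, whose associated closed quadratic form has a domain containing $C_c(X)$, and for which $D(H)\subseteq\mathcal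 F$ and $Hf=\mathcal Hf$ for all $f\in D(H)$. Here the quadratic form associated with $H$ is the densely defined, lower semi-bounded, closed form $q$ such that $D(H)=\{f\in D(q)\mid \exists g\in\ell^2(X,\mu)\ \forall h\in D(q):\ q(f,h)=\langle g,h\rangle\}$ and $Hf=g$. Such a form satisfies the first Beurling–Deny criterion if $f\in D(q)$ implies $|f|\in D(q)$ and $q(|f|)\le q(f)$. Then $\mathcal H$ has a realization whose associated quadratic form satisfies the first Beurling–Deny criterion if and only if $V$ is admissible, i.e. there is a constant $C\in\mathbb R$ with $\mathcal Q^c_V(\varphi)\ge C\|\varphi\|^2$ for all $\varphi\in C_c(X)$. -/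

import Mathlib

open MeasureTheory Filter Topology
open scoped ENNReal ComplexConjugate

namespace DiscreteSchrodinger

/-- A (symmetric) weighted graph over the vertex set `X`: a nonnegative edge weight which vanishes
on the diagonal, is symmetric, and is summable around every vertex. -/
structure WeightedGraph (X : Type*) where
  weight : X → X → ℝ
  weight_nonneg : ∀ x y, 0 ≤ weight x y
  weight_self : ∀ x, weight x x = 0
  weight_symm : ∀ x y, weight x y = weight y x
  summable_weight : ∀ x, Summable fun y => weight x y

/-! ### The Hilbert space of square summable functions -/

section Ell2

variable {X : Type*} [MeasurableSpace X]

/-- The measure `A ↦ ∑ x ∈ A, μ x` induced by a weight `μ : X → (0, ∞)`. -/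
noncomputable def weightMeasure (μ : X → ℝ) : Measure X :=
  Measure.sum fun x => ENNReal.ofReal (μ x) • Measure.dirac x

/-- The Hilbert space `ℓ²(X, μ)`, with inner product `⟪f, g⟫ = ∑ x, conj (f x) * g x * μ x`.
If `μ` is strictly positive, every vertex has positive mass, so that an element of this space is
uniquely represented by a function on `X` (see `forall_of_ae_weightMeasure`, `ell2_inner_eq`). -/
noncomputable abbrev Ell2 (μ : X → ℝ) := Lp ℂ 2 (weightMeasure μ)

theorem forall_of_ae_weightMeasure [DiscreteMeasurableSpace X] {μ : X → ℝ} (hμ : ∀ x, 0 < μ x)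
    {p : X → Prop} (h : ∀ᵐ x ∂(weightMeasure μ), p x) : ∀ x, p x := by
  intro x
  have h1 := (Measure.ae_sum_iff' (MeasurableSet.of_discrete)).1 h x
  rw [Measure.ae_ennreal_smul_measure_iff
    (by simpa using hμ x), ae_dirac_iff MeasurableSet.of_discrete] at h1
  exact h1

theorem coe_toLp_apply [DiscreteMeasurableSpace X] {μ : X → ℝ} (hμ : ∀ x, 0 < μ x) {f : X → ℂ}
    (hf : MemLp f 2 (weightMeasure μ)) (x : X) : hf.toLp f x = f x :=
  forall_of_ae_weightMeasure hμ hf.coeFn_toLp x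

theorem memLp_of_finite_support [Countable X] [DiscreteMeasurableSpace X] {μ : X → ℝ} (f : X → ℂ)
    (hf : (Function.support f).Finite) : MemLp f 2 (weightMeasure μ) := by
  refine ⟨(Measurable.of_discrete).aestronglyMeasurable, ?_⟩
  rw [eLpNorm_lt_top_iff_lintegral_rpow_enorm_lt_top (by simp) (by simp)]
  simp only [ENNReal.toReal_ofNat]
  simp only [weightMeasure, lintegral_sum_measure, lintegral_smul_measure, lintegral_dirac,
    smul_eq_mul]
  rw [tsum_eq_sum (s := hf.toFinset)]
  · refine ENNReal.sum_lt_top.2 fun x _ => ENNReal.mul_lt_top (by simp) (by simp)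
  · intro x hx
    simp at hx
    simp [hx]

theorem ell2_inner_eq [Countable X] [DiscreteMeasurableSpace X] {μ : X → ℝ} (hμ : ∀ x, 0 < μ x)
    (f g : Ell2 μ) : inner ℂ f g = ∑' x, conj (f x) * g x * (μ x : ℂ) := by
  rw [L2.inner_def]
  have := L2.integrable_inner (𝕜 := ℂ) f g
  unfold weightMeasure at this
  have h2 := integral_sum_measure this
  refine h2.trans ?_
  congr 1; ext x
  rw [integral_smul_measure, integral_dirac, ENNReal.toReal_ofReal (hμ x).le]
  simp [mul_comm]
  exact Or.inl rfl

/-- The pointwise absolute value `|f| ∈ ℓ²(X, μ)` of `f ∈ ℓ²(X, μ)`. -/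
noncomputable def absEll2 {μ : X → ℝ} (f : Ell2 μ) : Ell2 μ :=
  MemLp.toLp (fun x => ((‖f x‖ : ℝ) : ℂ)) (Lp.memLp f).norm.ofReal

end Ell2

/-! ### Quadratic forms on a complex Hilbert space -/

/-- A quadratic form on `K`, given by its domain (the subspace on which it is finite) and the
symmetric sesquilinear form (antilinear in the first argument) which it induces there. -/
structure QuadForm (K : Type*) [NormedAddCommGroup K] [InnerProductSpace ℂ K] where
  domain : Submodule ℂ K
  sesq : domain →ₗ⋆[ℂ] domain →ₗ[ℂ] ℂ
  symm : ∀ f g, conj (sesq f g) = sesq g f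

namespace QuadForm

variable {K : Type*} [NormedAddCommGroup K] [InnerProductSpace ℂ K]

/-- The value `q(f) = q(f, f)`, which is real by symmetry. -/
noncomputable def val (q : QuadForm K) (f : q.domain) : ℝ := (q.sesq f f).re

def DenselyDefined (q : QuadForm K) : Prop := Dense (q.domain : Set K)

def LowerSemibounded (q : QuadForm K) : Prop :=
  ∃ C : ℝ, ∀ f : q.domain, C * ‖(f : K)‖ ^ 2 ≤ q.val f

/-- The form is closed: its domain is complete with respect to the form norm. For a lower
semi-bounded form, a sequence is Cauchy (convergent) in the form norm iff it is Cauchy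
(convergent) in `K` and `q(u m - u n) → 0` (respectively `q(u n - f) → 0`); Cauchy sequences of
the Hilbert space `K` converge. -/
def Closed (q : QuadForm K) : Prop :=
  ∀ (u : ℕ → q.domain) (f : K),
    Tendsto (fun n => (u n : K)) atTop (𝓝 f) →
    Tendsto (fun p : ℕ × ℕ => q.val (u p.1 - u p.2)) atTop (𝓝 0) →
    ∃ hf : f ∈ q.domain, Tendsto (fun n => q.val (u n - ⟨f, hf⟩)) atTop (𝓝 0)

/-- `q` is the quadratic form associated with the operator `L`: it is a densely defined, lower
semi-bounded, closed form, and `L` is the operator with domain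
`{f ∈ D(q) | ∃ g, ∀ h ∈ D(q), q(f, h) = ⟪g, h⟫}` which acts by `L f = g`. -/
structure IsFormOf (q : QuadForm K) (L : K →ₗ.[ℂ] K) : Prop where
  denselyDefined : q.DenselyDefined
  lowerSemibounded : q.LowerSemibounded
  closed : q.Closed
  mem_graph_iff : ∀ f g : K, (f, g) ∈ L.graph ↔
    ∃ hf : f ∈ q.domain, ∀ h : q.domain, q.sesq ⟨f, hf⟩ h = inner ℂ g (h : K)

/-- The first Beurling–Deny criterion: `f ∈ D(q)` implies `|f| ∈ D(q)` and `q(|f|) ≤ q(f)`. -/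
def FirstBeurlingDeny {X : Type*} [MeasurableSpace X] {μ : X → ℝ} (q : QuadForm (Ell2 μ)) : Prop :=
  ∀ f : q.domain, ∃ h : absEll2 (f : Ell2 μ) ∈ q.domain, q.val ⟨absEll2 (f : Ell2 μ), h⟩ ≤ q.val f

end QuadForm

/-! ### Formal Schrödinger operators, Schrödinger forms and realizations -/

section Schrodinger

variable {X : Type*}

/-- The domain `ℱ` of the formal Schrödinger operator. -/
def formalDomain (b : WeightedGraph X) : Set (X → ℂ) :=
  {f | ∀ x, Summable fun y => b.weight x y * ‖f y‖}

/-- The formal Schrödinger operator, acting on functions in `formalDomain b` by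
`ℋ f(x) = (1 / μ x) * ∑ y, b(x, y) (f x - f y) + V x * f x`. -/
noncomputable def formalOperator (b : WeightedGraph X) (μ V : X → ℝ) (f : X → ℂ) (x : X) : ℂ :=
  (1 / (μ x : ℂ)) * ∑' y, (b.weight x y : ℂ) * (f x - f y) + (V x : ℂ) * f x

/-- The value of the Schrödinger form `𝒬_V`, used for functions of finite support (for which both
sums converge). -/
noncomputable def schrodingerForm (b : WeightedGraph X) (μ V : X → ℝ) (f : X → ℂ) : ℝ :=
  (1 / 2) * ∑' p : X × X, b.weight p.1 p.2 * ‖f p.1 - f p.2‖ ^ 2 + ∑' x, V x * ‖f x‖ ^ 2 * μ x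

variable [MeasurableSpace X]

/-- `V` is admissible: the restriction `𝒬ᶜ_V` of the Schrödinger form to the finitely supported
functions is lower semi-bounded on `ℓ²(X, μ)`. -/
def Admissible (b : WeightedGraph X) (μ V : X → ℝ) : Prop :=
  ∃ C : ℝ, ∀ φ : Ell2 μ, (Function.support φ).Finite → C * ‖φ‖ ^ 2 ≤ schrodingerForm b μ V φ

/-- `H` is a realization of the formal Schrödinger operator with data `b`, `μ`, `V`, and `q` is the
quadratic form associated with `H`. -/
structure IsRealizationWithForm (b : WeightedGraph X) (μ V : X → ℝ)
    (H : Ell2 μ →ₗ.[ℂ] Ell2 μ) (q : QuadForm (Ell2 μ)) : Prop where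
  isSelfAdjoint : IsSelfAdjoint H
  lowerSemibounded : ∃ C : ℝ, ∀ f : H.domain,
    C * ‖(f : Ell2 μ)‖ ^ 2 ≤ (inner ℂ (f : Ell2 μ) (H f)).re
  isFormOf : q.IsFormOf H
  mem_form_domain : ∀ φ : Ell2 μ, (Function.support φ).Finite → φ ∈ q.domain
  mem_formalDomain : ∀ f : H.domain, ((f : Ell2 μ) : X → ℂ) ∈ formalDomain b
  eq_formalOperator : ∀ (f : H.domain) (x : X), H f x = formalOperator b μ V (f : Ell2 μ) x

end Schrodinger

end DiscreteSchrodinger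

namespace DiscreteSchrodinger

/-! ### Closed forms and their operators -/

namespace QuadForm

variable {K : Type*} [NormedAddCommGroup K] [InnerProductSpace ℂ K]

/-! Necessity (`IsRealizationWithForm.admissible`). The form `q` of a realization is not assumed to
agree with `𝒬ᶜ_V` on finitely supported functions; the formal operator is only known on `D(H)`. So a
finitely supported `φ ≥ 0` is approximated by `f_n = α_n (H + α_n)⁻¹ φ`, with `α_n → ∞`. The
Beurling–Deny criterion gives `f_n ≥ 0` (`resolvent_eq_abs`), and `q(f_n, φ) ≥ C ‖f_n‖²`
(`QuadForm.resolvent_lower_bound`). Now `q(f_n, φ)` is a finite combination of values of `ℋ f_n`.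
The terms `-b(x,y) f_n(y)` with `y` outside the support of `φ` are nonpositive, hence may be
dropped, and the remaining finite sum converges to `𝒬ᶜ_V(φ)`. General `φ` follow from `𝒬ᶜ_V(|φ|) ≤
𝒬ᶜ_V(φ)`.

Sufficiency (`Admissible.exists_realization`). Admissibility yields some `w > 0` with `(ℋ - c) w ≥
0` (`Admissible.exists_supersolution`), as a pointwise limit of solutions on finite sets. The ground
state transform suggests the form `½ ∑ b(x,y) w(x) w(y) |f(x)/w(x) - f(y)/w(y)|² + ∑ k |f|² + c
‖f‖²`, where `k = μ (ℋ - c) w / w ≥ 0`, on its maximal domain. Being a sum of squares of continuous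
functionals plus a multiple of the norm, it is closed; Beurling–Deny holds termwise; and testing
with `δ_x` (`sesq_deltaEll2`) shows that its operator acts as `ℋ`. -/

theorem re_add_inner_self (a : ℂ) (α : ℝ) (x : K) :
    (a + α * inner ℂ x x).re = a.re + α * ‖x‖ ^ 2 := by
  have h : inner ℂ x x = ((‖x‖ ^ 2 : ℝ) : ℂ) := by
    rw [inner_self_eq_norm_sq_to_K]
    norm_cast
  rw [h, Complex.add_re, Complex.re_ofReal_mul, Complex.ofReal_re]

/-- The domain of a quadratic form, to be equipped with the inner product of the form. -/
def FormSpace (q : QuadForm K) : Type _ := q.domain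

instance (q : QuadForm K) : AddCommGroup q.FormSpace := inferInstanceAs (AddCommGroup q.domain)

noncomputable instance (q : QuadForm K) : Module ℂ q.FormSpace :=
  inferInstanceAs (Module ℂ q.domain)

/-- The inner product `q(f, g) + α ⟪f, g⟫` on the domain of a form with lower bound `C > -α`. -/
@[reducible]
noncomputable def formCore (q : QuadForm K) {C α : ℝ}
    (hq : ∀ f : q.domain, C * ‖(f : K)‖ ^ 2 ≤ q.val f) (hα : 0 < C + α) :
    InnerProductSpace.Core ℂ q.FormSpace where
  inner f g := q.sesq f g + α * inner ℂ (q.domain.subtype f) (q.domain.subtype g)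
  conj_inner_symm f g := by
    simp only [map_add, map_mul, Complex.conj_ofReal, inner_conj_symm]
    congr 1
    exact q.symm g f
  re_inner_nonneg f := by
    have h1 : (q.sesq f f).re = q.val f := rfl
    have h2 := hq f
    rw [RCLike.re_to_complex, re_add_inner_self, h1]
    have h3 : q.domain.subtype f = (f : q.domain).1 := rfl
    rw [h3]
    nlinarith [sq_nonneg ‖(f : q.domain).1‖]
  add_left f g h := by
    have h1 : q.sesq (f + g) h = q.sesq f h + q.sesq g h := q.sesq.map_add₂ f g h
    have h2 : q.domain.subtype (f + g) = q.domain.subtype f + q.domain.subtype g :=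
      map_add q.domain.subtype _ _
    simp only [h1, h2, inner_add_left]
    ring
  smul_left f g r := by
    have h1 : q.sesq (r • f) g = conj r * q.sesq f g := q.sesq.map_smulₛₗ₂ r f g
    have h2 : q.domain.subtype (r • f) = r • q.domain.subtype f :=
      map_smul q.domain.subtype _ _
    simp only [h1, h2, inner_smul_left]
    ring
  definite f hf := by
    have h0 : (q.sesq f f).re = q.val f := rfl
    have h1 := hq f
    have h2 := congrArg Complex.re hf
    rw [re_add_inner_self, h0, Complex.zero_re] at h2
    have h3 : q.domain.subtype f = (f : q.domain).1 := rfl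
    rw [h3] at h2
    have h4 : ‖(f : q.domain).1‖ ^ 2 = 0 := by
      nlinarith [sq_nonneg ‖(f : q.domain).1‖]
    have h5 : (f : q.domain).1 = 0 := by simpa using h4
    exact Subtype.ext h5

/-- Solvability of `(L + α) f = g` for the operator `L` of a closed form with lower bound
`C > -α`. -/
theorem exists_resolvent [CompleteSpace K] (q : QuadForm K) (hcl : q.Closed) {C α : ℝ}
    (hq : ∀ f : q.domain, C * ‖(f : K)‖ ^ 2 ≤ q.val f) (hα : 0 < C + α) (g : K) :
    ∃ f : q.domain, ∀ h : q.domain,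
      q.sesq f h + α * inner ℂ (f : K) (h : K) = inner ℂ g (h : K) := by
  let core := q.formCore hq hα
  let : NormedAddCommGroup q.FormSpace := core.toNormedAddCommGroup
  let : InnerProductSpace ℂ q.FormSpace := InnerProductSpace.ofCore core.toCore
  have inner_def : ∀ f h : q.FormSpace, inner ℂ f h =
    q.sesq f h + α * inner ℂ (f : q.domain).1 (h : q.domain).1 := fun _ _ => rfl
  have norm_def : ∀ f : q.FormSpace, ‖f‖ ^ 2 =
      q.val f + α * ‖(f : q.domain).1‖ ^ 2 := by
    intro f
    have h0 : (q.sesq f f).re = q.val f := rfl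
    rw [@norm_sq_eq_re_inner ℂ, inner_def, RCLike.re_to_complex, re_add_inner_self, h0]
  have bound : ∀ f : q.FormSpace, ‖(f : q.domain).1‖ ≤ (√(C + α))⁻¹ * ‖f‖ := by
    intro f
    have h1 := norm_def f
    have h2 := hq f
    rw [inv_mul_eq_div, le_div_iff₀ (Real.sqrt_pos.2 hα)]
    apply le_of_sq_le_sq _ (norm_nonneg _)
    rw [mul_pow, Real.sq_sqrt hα.le, h1]
    nlinarith
  let ι : q.FormSpace →L[ℂ] K :=
    LinearMap.mkContinuous (q.domain.subtype : q.FormSpace →ₗ[ℂ] K) _ bound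
  have hι : ∀ f : q.FormSpace, ι f = (f : q.domain).1 := fun _ => rfl
  -- A Cauchy sequence in the form norm is Cauchy in `K`, and `q` tends to 0 on its differences, so
  -- closedness supplies the limit.
  have : CompleteSpace q.FormSpace := by
    apply Metric.complete_of_cauchySeq_tendsto
    intro u hu
    have h1 : CauchySeq fun n => ι (u n) := hu.map ι.uniformContinuous
    obtain ⟨f, hf⟩ := cauchySeq_tendsto_of_complete h1
    have key : ∀ v w : q.FormSpace, q.val ((v : q.domain) - (w : q.domain)) =
        dist v w ^ 2 - α * dist (ι v) (ι w) ^ 2 := by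
      intro v w
      rw [dist_eq_norm, dist_eq_norm, norm_def, ← map_sub, hι]
      have : q.val ((v : q.domain) - (w : q.domain)) = q.val (v - w : q.FormSpace) := rfl
      rw [this]
      ring
    obtain ⟨hfm, hlim⟩ := hcl u f hf (by
      have h2 := ((cauchySeq_iff_tendsto_dist_atTop_0.1 hu).pow 2).sub
        (((cauchySeq_iff_tendsto_dist_atTop_0.1 h1).pow 2).const_mul α)
      simp only [ne_eq, OfNat.ofNat_ne_zero, not_false_eq_true, zero_pow, mul_zero, sub_zero] at h2
      refine h2.congr' (prod_atTop_atTop_eq (α := ℕ) (β := ℕ) ▸ Eventually.of_forall ?_)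
      intro p
      exact (key _ _).symm)
    let f' : q.FormSpace := (⟨f, hfm⟩ : q.domain)
    refine ⟨f', ?_⟩
    rw [tendsto_iff_dist_tendsto_zero]
    have h3 : Tendsto (fun n => dist (ι (u n)) (ι f')) atTop (𝓝 0) :=
      tendsto_iff_dist_tendsto_zero.1 hf
    have h4 := hlim.add ((h3.pow 2).const_mul α)
    simp only [ne_eq, OfNat.ofNat_ne_zero, not_false_eq_true, zero_pow, mul_zero, add_zero] at h4
    have h5 : Tendsto (fun n => dist (u n) f' ^ 2) atTop (𝓝 0) := by
      refine h4.congr fun n => ?_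
      have := key (u n) f'
      exact (eq_sub_iff_add_eq.1 this)
    have h7 := h5.sqrt
    simpa [Real.sqrt_sq dist_nonneg] using h7
  -- The functional `h ↦ ⟪g, h⟫` is bounded in the form norm; its Riesz representative is the
  -- solution.
  let φ : StrongDual ℂ q.FormSpace := (innerSL ℂ g).comp ι
  refine ⟨(InnerProductSpace.toDual ℂ q.FormSpace).symm φ, fun h => ?_⟩
  exact InnerProductSpace.toDual_symm_apply (𝕜 := ℂ) (E := q.FormSpace) (x := h) (y := φ)

/-- The graph of the operator associated with a quadratic form. -/
def opGraph (q : QuadForm K) : Submodule ℂ (K × K) where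
  carrier := {p | ∃ hf : p.1 ∈ q.domain, ∀ h : q.domain, q.sesq ⟨p.1, hf⟩ h = inner ℂ p.2 (h : K)}
  zero_mem' := ⟨q.domain.zero_mem, fun h => by
    have : q.sesq ⟨(0 : K × K).1, q.domain.zero_mem⟩ h = 0 := q.sesq.map_zero₂ h
    rw [this, Prod.snd_zero, inner_zero_left]⟩
  add_mem' := by
    rintro ⟨f, g⟩ ⟨f', g'⟩ ⟨hf, h1⟩ ⟨hf', h2⟩
    refine ⟨q.domain.add_mem hf hf', fun h => ?_⟩
    have : (⟨((f, g) + (f', g')).1, q.domain.add_mem hf hf'⟩ : q.domain) =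
      ⟨f, hf⟩ + ⟨f', hf'⟩ := rfl
    rw [this, LinearMap.map_add₂, h1, h2, Prod.snd_add, inner_add_left]
  smul_mem' := by
    rintro c ⟨f, g⟩ ⟨hf, h1⟩
    refine ⟨q.domain.smul_mem c hf, fun h => ?_⟩
    have : (⟨(c • (f, g)).1, q.domain.smul_mem c hf⟩ : q.domain) = c • ⟨f, hf⟩ := rfl
    rw [this, LinearMap.map_smulₛₗ₂, h1, Prod.smul_snd, inner_smul_left]
    rfl

/-- The operator associated with a (densely defined) quadratic form. -/
noncomputable def toOp (q : QuadForm K) : K →ₗ.[ℂ] K := q.opGraph.toLinearPMap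

/-- Density of the domain makes `g` unique for given `f`, so `opGraph` is the graph of an operator.
-/
theorem mem_toOp_graph_iff {q : QuadForm K} (hd : q.DenselyDefined) (f g : K) :
    (f, g) ∈ q.toOp.graph ↔
      ∃ hf : f ∈ q.domain, ∀ h : q.domain, q.sesq ⟨f, hf⟩ h = inner ℂ g (h : K) := by
  rw [toOp, Submodule.toLinearPMap_graph_eq]
  · rfl
  · rintro ⟨f, g⟩ ⟨hf, h1⟩ (rfl : f = 0)
    refine hd.eq_zero_of_inner_left ℂ fun h hh => ?_
    have := h1 ⟨h, hh⟩
    have h0 : (⟨((0 : K), g).1, hf⟩ : q.domain) = 0 := rfl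
    rw [h0] at this
    simpa using this.symm

theorem isFormOf_toOp {q : QuadForm K} (hd : q.DenselyDefined) (hb : q.LowerSemibounded)
    (hc : q.Closed) : q.IsFormOf q.toOp :=
  ⟨hd, hb, hc, mem_toOp_graph_iff hd⟩

namespace IsFormOf

variable {q : QuadForm K} {L : K →ₗ.[ℂ] K}

theorem apply_sesq (hL : q.IsFormOf L) (f : L.domain) :
    ∃ hf : (f : K) ∈ q.domain, ∀ h : q.domain, q.sesq ⟨f, hf⟩ h = inner ℂ (L f) (h : K) :=
  (hL.mem_graph_iff _ _).1 (L.mem_graph f)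

theorem inner_comm (hL : q.IsFormOf L) (f g : L.domain) :
    inner ℂ (L f) (g : K) = inner ℂ (f : K) (L g) := by
  obtain ⟨hf, h1⟩ := hL.apply_sesq f
  obtain ⟨hg, h2⟩ := hL.apply_sesq g
  rw [← inner_conj_symm (f : K) (L g)]
  have h3 := h1 ⟨g, hg⟩
  have h4 := h2 ⟨f, hf⟩
  simp only at h3 h4
  rw [← h3, ← h4, q.symm]

theorem lower_bound (hL : q.IsFormOf L) :
    ∃ C : ℝ, ∀ f : L.domain, C * ‖(f : K)‖ ^ 2 ≤ (inner ℂ (f : K) (L f)).re := by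
  obtain ⟨C, hC⟩ := hL.lowerSemibounded
  refine ⟨C, fun f => ?_⟩
  obtain ⟨hf, h1⟩ := hL.apply_sesq f
  have h2 := hC ⟨f, hf⟩
  rwa [val, h1, hL.inner_comm] at h2

theorem exists_add_eq [CompleteSpace K] (hL : q.IsFormOf L) :
    ∃ α : ℝ, ∀ g : K, ∃ f : L.domain, L f + (α : ℂ) • (f : K) = g := by
  obtain ⟨C, hC⟩ := hL.lowerSemibounded
  refine ⟨1 - C, fun g => ?_⟩
  obtain ⟨f, hf⟩ := q.exists_resolvent hL.closed hC (α := 1 - C) (by linarith) g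
  have h1 : ((f : K), g - ((1 - C : ℝ) : ℂ) • (f : K)) ∈ L.graph := by
    refine (hL.mem_graph_iff _ _).2 ⟨f.2, fun h => ?_⟩
    rw [inner_sub_left, ← hf h, inner_smul_left, Complex.conj_ofReal]
    simp
  obtain ⟨hm, h2⟩ := (LinearPMap.mem_graph_iff' L).1 h1
  rw [Prod.mk.injEq] at h2
  refine ⟨hm, ?_⟩
  rw [h2.1, h2.2]
  simp

/-- If `g ⊥ D(L)`, solve `(L + α) f = g` and test with `f`: then `q(f) + α ‖f‖² = 0`, which forces
`f = 0` and hence `g = 0`. -/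
theorem dense_domain [CompleteSpace K] (hL : q.IsFormOf L) : Dense (L.domain : Set K) := by
  rw [Submodule.dense_iff_topologicalClosure_eq_top,
    Submodule.topologicalClosure_eq_top_iff, Submodule.eq_bot_iff]
  intro g hg
  obtain ⟨C, hC⟩ := hL.lowerSemibounded
  obtain ⟨f, hf⟩ := q.exists_resolvent hL.closed hC (α := 1 - C) (by linarith) g
  have h1 : ((f : K), g - ((1 - C : ℝ) : ℂ) • (f : K)) ∈ L.graph := by
    refine (hL.mem_graph_iff _ _).2 ⟨f.2, fun h => ?_⟩
    rw [inner_sub_left, ← hf h, inner_smul_left, Complex.conj_ofReal]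
    simp
  have hfm : (f : K) ∈ L.domain := LinearPMap.mem_domain_of_mem_graph h1
  have h2 := hf f
  rw [(Submodule.mem_orthogonal' _ _).1 hg _ hfm] at h2
  have h3 := congrArg Complex.re h2
  rw [re_add_inner_self, Complex.zero_re] at h3
  have h4 := hC f
  rw [val] at h4
  have h5 : ‖(f : K)‖ ^ 2 = 0 := by
    nlinarith [sq_nonneg ‖(f : K)‖]
  have h6 : f = 0 := Subtype.ext (by simpa using h5)
  subst h6
  rw [LinearPMap.mem_graph_iff] at h1
  obtain ⟨y, hy, hy'⟩ := h1
  have hy0 : y = 0 := Subtype.ext (by simpa using hy)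
  subst hy0
  simpa using hy'.symm

/-- A densely defined symmetric operator with `L + α` surjective for a real `α` is self-adjoint: for
`v ∈ D(L*)` pick `u ∈ D(L)` with `(L + α) u = (L* + α) v`; then `v - u` is orthogonal to the range
of `L + α`. -/
theorem isSelfAdjoint [CompleteSpace K] (hL : q.IsFormOf L) : IsSelfAdjoint L := by
  have hd := hL.dense_domain
  rw [LinearPMap.isSelfAdjoint_def]
  have hform : L.IsFormalAdjoint L := fun f g => hL.inner_comm f g
  have hle : L ≤ L.adjoint := hform.le_adjoint hd
  refine le_antisymm ?_ hle
  refine LinearPMap.le_of_eqLocus_ge ?_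
  intro v hv
  obtain ⟨α, hα⟩ := hL.exists_add_eq
  obtain ⟨u, hu⟩ := hα (L.adjoint ⟨v, hv⟩ + (α : ℂ) • v)
  have hadj := LinearPMap.adjoint_isFormalAdjoint hd
  have hvu : v = u := by
    rw [← sub_eq_zero]
    obtain ⟨z, hz⟩ := hα (v - u)
    have h1 : inner ℂ (v - (u : K)) (v - (u : K)) = 0 := by
      nth_rewrite 2 [← hz]
      rw [inner_sub_left, inner_add_right, inner_add_right, inner_smul_right, inner_smul_right]
      have h2 := hadj ⟨v, hv⟩ z
      have h3 := hL.inner_comm u z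
      have h4 : inner ℂ (L u + (α : ℂ) • (u : K)) (z : K) =
        inner ℂ (L.adjoint ⟨v, hv⟩ + (α : ℂ) • v) (z : K) := by rw [hu]
      rw [inner_add_left, inner_add_left, inner_smul_left, inner_smul_left,
        Complex.conj_ofReal] at h4
      simp only at h2
      rw [← h2, ← h3]
      linear_combination -h4
    simpa using h1
  exact ⟨hv, hvu ▸ u.2, (hle.2 (by simp)).symm⟩

end IsFormOf

/-! ### Forms given by families of functionals -/

section OfFunctionals

variable {ι : Type*}

/-- The subspace on which the family of functionals `T` is square summable. -/
def sqSummableDomain (T : K →ₗ[ℂ] (ι → ℂ)) : Submodule ℂ K where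
  carrier := {f | Memℓp (T f) 2}
  zero_mem' := by simpa using zero_memℓp
  add_mem' := fun hf hg => by simpa using hf.add hg
  smul_mem' := fun c _ hf => by simpa using hf.const_smul c

/-- The family of functionals `T`, as a map into the space of square summable families. -/
noncomputable def toEll2 (T : K →ₗ[ℂ] (ι → ℂ)) :
    sqSummableDomain T →ₗ[ℂ] lp (fun _ : ι => ℂ) 2 where
  toFun f := ⟨T f, f.2⟩
  map_add' _ _ := lp.ext (map_add T _ _)
  map_smul' _ _ := lp.ext (map_smul T _ _)

@[simp]
theorem toEll2_apply (T : K →ₗ[ℂ] (ι → ℂ)) (f : sqSummableDomain T) (i : ι) :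
    toEll2 T f i = T f i := rfl

/-- The quadratic form `∑ i, |T f i|² + c ‖f‖²`. -/
noncomputable def ofFunctionals (T : K →ₗ[ℂ] (ι → ℂ)) (c : ℝ) : QuadForm K where
  domain := sqSummableDomain T
  sesq := LinearMap.mk₂'ₛₗ (starRingEnd ℂ) (RingHom.id ℂ)
    (fun f g => inner ℂ (toEll2 T f) (toEll2 T g) + c * inner ℂ (f : K) (g : K))
    (fun f g h => by simp only [map_add, Submodule.coe_add, inner_add_left]; ring)
    (fun a f g => by
      simp only [map_smul, Submodule.coe_smul, inner_smul_left, smul_eq_mul]; ring)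
    (fun f g h => by simp only [map_add, Submodule.coe_add, inner_add_right]; ring)
    (fun a f g => by
      simp only [map_smul, Submodule.coe_smul, inner_smul_right, smul_eq_mul, RingHom.id_apply]
      ring)
  symm f g := by simp

theorem ofFunctionals_sesq (T : K →ₗ[ℂ] (ι → ℂ)) (c : ℝ) (f g : (ofFunctionals T c).domain) :
    (ofFunctionals T c).sesq f g =
      inner ℂ (toEll2 T f) (toEll2 T g) + c * inner ℂ (f : K) (g : K) := rfl

theorem ofFunctionals_val (T : K →ₗ[ℂ] (ι → ℂ)) (c : ℝ) (f : (ofFunctionals T c).domain) :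
    (ofFunctionals T c).val f = ‖toEll2 T f‖ ^ 2 + c * ‖(f : K)‖ ^ 2 := by
  rw [val, ofFunctionals_sesq, re_add_inner_self]
  congr 1
  exact inner_self_eq_norm_sq (𝕜 := ℂ) _

theorem lowerSemibounded_ofFunctionals (T : K →ₗ[ℂ] (ι → ℂ)) (c : ℝ) :
    (ofFunctionals T c).LowerSemibounded :=
  ⟨c, fun f => by rw [ofFunctionals_val]; linarith [sq_nonneg ‖toEll2 T f‖]⟩

theorem closed_ofFunctionals {T : K →ₗ[ℂ] (ι → ℂ)} (hT : ∀ i, Continuous fun f => T f i) (c : ℝ) :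
    (ofFunctionals T c).Closed := by
  intro u f hu hcau
  have h1 : CauchySeq fun n => ((u n : K)) := hu.cauchySeq
  have h2 : CauchySeq fun n => toEll2 T (u n) := by
    rw [cauchySeq_iff_tendsto_dist_atTop_0]
    have h3 := hcau.sub (((cauchySeq_iff_tendsto_dist_atTop_0.1 h1).pow 2).const_mul c)
    simp only [ne_eq, OfNat.ofNat_ne_zero, not_false_eq_true, zero_pow, mul_zero, sub_zero] at h3
    have h4 := h3.sqrt
    rw [Real.sqrt_zero] at h4
    refine h4.congr fun p => ?_
    have h5 : toEll2 T (u p.1 - u p.2) = toEll2 T (u p.1) - toEll2 T (u p.2) :=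
      map_sub (toEll2 T) _ _
    rw [ofFunctionals_val, dist_eq_norm, dist_eq_norm, h5, Submodule.coe_sub,
      add_sub_cancel_right, Real.sqrt_sq (norm_nonneg _)]
  obtain ⟨w, hw⟩ := cauchySeq_tendsto_of_complete h2
  -- Continuity of each functional identifies the `ℓ²` limit `w` coordinate by coordinate.
  have h5 : T f = w := by
    ext i
    refine tendsto_nhds_unique (((hT i).tendsto f).comp hu) ?_
    exact ((lp.lipschitzWith_one_eval 2 i).continuous.tendsto w).comp hw
  have hf : f ∈ (ofFunctionals T c).domain := by
    change Memℓp (T f) 2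
    rw [h5]
    exact lp.memℓp w
  have h6 : toEll2 T ⟨f, hf⟩ = w := lp.ext h5
  refine ⟨hf, ?_⟩
  have h7 := ((tendsto_iff_norm_sub_tendsto_zero.1 hw).pow 2).add
    (((tendsto_iff_norm_sub_tendsto_zero.1 hu).pow 2).const_mul c)
  simp only [ne_eq, OfNat.ofNat_ne_zero, not_false_eq_true, zero_pow, mul_zero, add_zero] at h7
  refine h7.congr fun n => ?_
  have h8 : ∀ v v' : (ofFunctionals T c).domain, toEll2 T (v - v') = toEll2 T v - toEll2 T v' :=
    map_sub (toEll2 T)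
  rw [ofFunctionals_val, h8, Submodule.coe_sub, ← h6]
  rfl

end OfFunctionals

end QuadForm

/-! ### Elements of `ℓ²(X, μ)` as functions -/

section Ell2Functions

variable {X : Type*} [MeasurableSpace X] {μ : X → ℝ}

theorem ell2_ext {f g : Ell2 μ} (h : ∀ x, f x = g x) : f = g :=
  Lp.ext (ae_of_all _ h)

theorem norm_absEll2 (f : Ell2 μ) : ‖absEll2 f‖ = ‖f‖ := by
  have h : absEll2 f =ᵐ[weightMeasure μ] fun x => ((‖f x‖ : ℝ) : ℂ) := MemLp.coeFn_toLp _
  refine le_antisymm (Lp.norm_le_norm_of_ae_le ?_) (Lp.norm_le_norm_of_ae_le ?_) <;>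
  · filter_upwards [h] with x hx
    rw [hx]
    simp

variable [DiscreteMeasurableSpace X]

theorem ell2_add_apply (hμ : ∀ x, 0 < μ x) (f g : Ell2 μ) (x : X) : (f + g) x = f x + g x :=
  forall_of_ae_weightMeasure hμ (Lp.coeFn_add f g) x

theorem ell2_smul_apply (hμ : ∀ x, 0 < μ x) (c : ℂ) (f : Ell2 μ) (x : X) :
    (c • f) x = c * f x :=
  forall_of_ae_weightMeasure hμ (Lp.coeFn_smul c f) x

theorem absEll2_apply (hμ : ∀ x, 0 < μ x) (f : Ell2 μ) (x : X) :
    absEll2 f x = ((‖f x‖ : ℝ) : ℂ) :=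
  coe_toLp_apply hμ _ x

theorem support_absEll2 (hμ : ∀ x, 0 < μ x) (f : Ell2 μ) :
    Function.support (absEll2 f) = Function.support f := by
  ext x
  simp [absEll2_apply hμ]

/-- Evaluation at a vertex, as a linear functional. -/
noncomputable def evalEll2 (hμ : ∀ x, 0 < μ x) (x : X) : Ell2 μ →ₗ[ℂ] ℂ where
  toFun f := f x
  map_add' f g := ell2_add_apply hμ f g x
  map_smul' c f := ell2_smul_apply hμ c f x

theorem evalEll2_apply (hμ : ∀ x, 0 < μ x) (x : X) (f : Ell2 μ) : evalEll2 hμ x f = f x := rfl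

variable [Countable X]

theorem ell2_hasSum_inner (hμ : ∀ x, 0 < μ x) (f g : Ell2 μ) :
    HasSum (fun x => conj (f x) * g x * (μ x : ℂ)) (inner ℂ f g) := by
  rw [L2.inner_def]
  have h := hasSum_integral_measure (L2.integrable_inner (𝕜 := ℂ) f g)
  refine h.congr_fun fun x => ?_
  rw [integral_smul_measure, integral_dirac, ENNReal.toReal_ofReal (hμ x).le]
  simp [mul_comm]

theorem ell2_hasSum_norm_sq (hμ : ∀ x, 0 < μ x) (f : Ell2 μ) :
    HasSum (fun x => ‖f x‖ ^ 2 * μ x) (‖f‖ ^ 2) := by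
  have h := Complex.hasSum_re (ell2_hasSum_inner hμ f f)
  rw [← RCLike.re_to_complex, inner_self_eq_norm_sq] at h
  convert h using 2 with x
  rw [Complex.conj_mul', ← Complex.ofReal_pow, ← Complex.ofReal_mul, Complex.ofReal_re]

theorem ell2_norm_apply_sq_mul_le (hμ : ∀ x, 0 < μ x) (f : Ell2 μ) (x : X) :
    ‖f x‖ ^ 2 * μ x ≤ ‖f‖ ^ 2 := by
  exact le_hasSum (ell2_hasSum_norm_sq hμ f) x fun y _ =>
    mul_nonneg (sq_nonneg _) (hμ y).le

theorem continuous_apply_ell2 (hμ : ∀ x, 0 < μ x) (x : X) : Continuous fun f : Ell2 μ => f x := by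
  refine AddMonoidHomClass.continuous_of_bound (evalEll2 hμ x) (√(μ x))⁻¹ fun f => ?_
  rw [evalEll2_apply, inv_mul_eq_div, le_div_iff₀ (Real.sqrt_pos.2 (hμ x))]
  apply le_of_sq_le_sq _ (norm_nonneg _)
  rw [mul_pow, Real.sq_sqrt (hμ x).le]
  exact ell2_norm_apply_sq_mul_le hμ f x

theorem ell2_inner_eq_sum (hμ : ∀ x, 0 < μ x) (f g : Ell2 μ) {s : Finset X}
    (hs : ∀ x ∉ s, g x = 0) : inner ℂ f g = ∑ x ∈ s, conj (f x) * g x * (μ x : ℂ) := by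
  rw [ell2_inner_eq hμ]
  exact tsum_eq_sum fun x hx => by simp [hs x hx]

theorem ell2_norm_sq_eq_sum (hμ : ∀ x, 0 < μ x) (f : Ell2 μ) {s : Finset X}
    (hs : ∀ x ∉ s, f x = 0) : ‖f‖ ^ 2 = ∑ x ∈ s, ‖f x‖ ^ 2 * μ x := by
  rw [@norm_sq_eq_re_inner ℂ, ell2_inner_eq_sum hμ f f hs]
  rw [RCLike.re_to_complex, Complex.re_sum]
  refine Finset.sum_congr rfl fun x _ => ?_
  rw [Complex.conj_mul', ← Complex.ofReal_pow, ← Complex.ofReal_mul, Complex.ofReal_re]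

/-- The element of `ℓ²(X, μ)` given by a finitely supported function. -/
noncomputable def ell2OfFiniteSupport (μ : X → ℝ) (φ : X → ℂ) (hφ : (Function.support φ).Finite) :
    Ell2 μ :=
  (memLp_of_finite_support φ hφ).toLp φ

theorem ell2OfFiniteSupport_apply (hμ : ∀ x, 0 < μ x) (φ : X → ℂ)
    (hφ : (Function.support φ).Finite) (x : X) : ell2OfFiniteSupport μ φ hφ x = φ x :=
  coe_toLp_apply hμ _ x

/-- The indicator function of a vertex. -/
noncomputable def deltaEll2 [DecidableEq X] (μ : X → ℝ) (x : X) : Ell2 μ :=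
  ell2OfFiniteSupport μ (Pi.single x 1)
    ((Set.finite_singleton x).subset Pi.support_single_subset)

theorem deltaEll2_apply [DecidableEq X] (hμ : ∀ x, 0 < μ x) (x y : X) :
    deltaEll2 μ x y = if y = x then 1 else 0 := by
  rw [deltaEll2, ell2OfFiniteSupport_apply hμ, Pi.single_apply]

theorem inner_deltaEll2 [DecidableEq X] (hμ : ∀ x, 0 < μ x) (f : Ell2 μ) (x : X) :
    inner ℂ f (deltaEll2 μ x) = conj (f x) * (μ x : ℂ) := by
  rw [ell2_inner_eq_sum hμ _ _ (s := {x}) (fun y hy => ?_)]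
  · simp [deltaEll2_apply hμ]
  · rw [deltaEll2_apply hμ, if_neg (by simpa using hy)]

theorem dense_of_deltaEll2_mem [DecidableEq X] (hμ : ∀ x, 0 < μ x) {D : Submodule ℂ (Ell2 μ)}
    (hD : ∀ x, deltaEll2 μ x ∈ D) : Dense (D : Set (Ell2 μ)) := by
  rw [Submodule.dense_iff_topologicalClosure_eq_top,
    Submodule.topologicalClosure_eq_top_iff, Submodule.eq_bot_iff]
  intro g hg
  refine ell2_ext fun x => ?_
  have h := (Submodule.mem_orthogonal' _ _).1 hg _ (hD x)
  rw [inner_deltaEll2 hμ] at h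
  have h0 : (0 : Ell2 μ) x = 0 := map_zero (evalEll2 hμ x)
  rw [h0]
  simpa [(hμ x).ne'] using h

theorem mem_of_finite_support_of_deltaEll2_mem [DecidableEq X] (hμ : ∀ x, 0 < μ x)
    {D : Submodule ℂ (Ell2 μ)} (hD : ∀ x, deltaEll2 μ x ∈ D) (φ : Ell2 μ)
    (hφ : (Function.support φ).Finite) : φ ∈ D := by
  have h : φ = ∑ x ∈ hφ.toFinset, φ x • deltaEll2 μ x := by
    refine ell2_ext fun y => ?_
    rw [← evalEll2_apply hμ y (∑ x ∈ hφ.toFinset, φ x • deltaEll2 μ x), map_sum]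
    simp only [map_smul, evalEll2_apply, deltaEll2_apply hμ, smul_eq_mul, mul_ite, mul_one,
      mul_zero, Finset.sum_ite_eq, Set.Finite.mem_toFinset, Function.mem_support]
    split_ifs with hy
    · rfl
    · simpa using hy
  rw [h]
  exact D.sum_mem fun x _ => D.smul_mem _ (hD x)

end Ell2Functions

/-! ### Resolvents of forms -/

namespace QuadForm

variable {K : Type*} [NormedAddCommGroup K] [InnerProductSpace ℂ K]

theorem val_sub (q : QuadForm K) (f g : q.domain) :
    q.val (f - g) = q.val f - 2 * (q.sesq f g).re + q.val g := by
  have h : (q.sesq g f).re = (q.sesq f g).re := by rw [← q.symm f g, Complex.conj_re]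
  rw [val, LinearMap.map_sub₂, map_sub, map_sub, Complex.sub_re, Complex.sub_re, Complex.sub_re, h,
    val, val]
  ring

variable {q : QuadForm K} {C α : ℝ} {f φ : q.domain}

/-- The real part of the resolvent equation, tested with `h`. -/
theorem re_resolvent_eq
    (hf : ∀ h : q.domain, q.sesq f h + α * inner ℂ (f : K) (h : K) =
      inner ℂ ((α : ℂ) • (φ : K)) (h : K)) (h : q.domain) :
    (q.sesq f h).re + α * (inner ℂ (f : K) (h : K)).re = α * (inner ℂ (φ : K) (h : K)).re := by
  have := congrArg Complex.re (hf h)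
  rwa [inner_smul_left, Complex.conj_ofReal, Complex.add_re, Complex.re_ofReal_mul,
    Complex.re_ofReal_mul] at this

theorem re_inner_self (x : K) : (inner ℂ x x).re = ‖x‖ ^ 2 := inner_self_eq_norm_sq (𝕜 := ℂ) x

theorem norm_sub_sq_complex (x y : K) :
    ‖x - y‖ ^ 2 = ‖x‖ ^ 2 - 2 * (inner ℂ x y).re + ‖y‖ ^ 2 := norm_sub_sq (𝕜 := ℂ) x y

/-- Testing the equation with `f` and with `φ` and subtracting gives `Re q(f, φ) = q(f) + α ‖f -
φ‖²`. -/
theorem resolvent_lower_bound (hq : ∀ f : q.domain, C * ‖(f : K)‖ ^ 2 ≤ q.val f) (hα : 0 ≤ α)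
    (hf : ∀ h : q.domain, q.sesq f h + α * inner ℂ (f : K) (h : K) =
      inner ℂ ((α : ℂ) • (φ : K)) (h : K)) :
    C * ‖(f : K)‖ ^ 2 ≤ (q.sesq f φ).re := by
  have h1 := re_resolvent_eq hf f
  have h2 := re_resolvent_eq hf φ
  have h3 := norm_sub_sq_complex (f : K) (φ : K)
  have h4 : (inner ℂ (φ : K) (f : K)).re = (inner ℂ (f : K) (φ : K)).re :=
    inner_re_symm (𝕜 := ℂ) _ _
  rw [re_inner_self, ← val] at h1
  rw [re_inner_self] at h2
  have h5 := hq f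
  have h6 := mul_nonneg hα (sq_nonneg ‖(f : K) - φ‖)
  rw [h3] at h6
  rw [h4] at h1
  linarith

/-- Quantifies `α (L + α)⁻¹ φ → φ` at rate `1/α` for the squared norm. It combines `Re q(f, φ) =
q(f) + α ‖f - φ‖²` with the lower bounds for `q(f)` and `q(f - φ)`. -/
theorem norm_resolvent_sub_sq_le (hq : ∀ f : q.domain, C * ‖(f : K)‖ ^ 2 ≤ q.val f) (hC : C ≤ 0)
    (hα : 0 ≤ α + C)
    (hf : ∀ h : q.domain, q.sesq f h + α * inner ℂ (f : K) (h : K) =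
      inner ℂ ((α : ℂ) • (φ : K)) (h : K)) :
    (α + 2 * C) * ‖(f : K) - φ‖ ^ 2 ≤ q.val φ - 2 * C * ‖(φ : K)‖ ^ 2 := by
  have h1 := re_resolvent_eq hf f
  have h2 := re_resolvent_eq hf φ
  have h3 := norm_sub_sq_complex (f : K) (φ : K)
  have h4 : (inner ℂ (φ : K) (f : K)).re = (inner ℂ (f : K) (φ : K)).re :=
    inner_re_symm (𝕜 := ℂ) _ _
  rw [re_inner_self, ← val] at h1
  rw [re_inner_self] at h2
  rw [h4] at h1
  have h5 := hq f
  have h6 := hq (f - φ)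
  rw [val_sub, Submodule.coe_sub] at h6
  have h7 := mul_nonneg hα (sq_nonneg ‖(f : K) - φ‖)
  have h8 : ‖(f : K)‖ ^ 2 ≤ 2 * ‖(f : K) - φ‖ ^ 2 + 2 * ‖(φ : K)‖ ^ 2 := by
    have h9 := norm_sub_sq_complex (f : K) ((2 : ℂ) • (φ : K))
    rw [inner_smul_right, norm_smul] at h9
    simp at h9
    nlinarith [sq_nonneg ‖(f : K) - (2 : ℂ) • (φ : K)‖]
  have h11 := mul_le_mul_of_nonpos_left h8 hC
  rw [h3] at *
  linarith

end QuadForm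

/-! ### Positivity of resolvents under the first Beurling–Deny criterion -/

section

variable {X : Type*} [Countable X] [MeasurableSpace X] [DiscreteMeasurableSpace X] {μ : X → ℝ}

/-- The resolvent `f` is the unique minimizer of `v ↦ q(v) + α ‖v - φ‖²`, and for `φ ≥ 0` passing to
`|f|` does not increase this functional. The proof is the corresponding computation, `q(f - |f|) + α
‖f - |f|‖² ≤ 2α Re ⟪φ, f - |f|⟫ ≤ 0`. -/
theorem resolvent_eq_abs (hμ : ∀ x, 0 < μ x) {q : QuadForm (Ell2 μ)} {C α : ℝ}
    {f φ : q.domain} (hBD : q.FirstBeurlingDeny)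
    (hq : ∀ f : q.domain, C * ‖(f : Ell2 μ)‖ ^ 2 ≤ q.val f) (hα0 : 0 ≤ α) (hα : 0 < α + C)
    (hφ : ∀ x, (φ : Ell2 μ) x = ((‖(φ : Ell2 μ) x‖ : ℝ) : ℂ))
    (hf : ∀ h : q.domain, q.sesq f h + α * inner ℂ (f : Ell2 μ) (h : Ell2 μ) =
      inner ℂ ((α : ℂ) • (φ : Ell2 μ)) (h : Ell2 μ)) :
    absEll2 (f : Ell2 μ) = f := by
  obtain ⟨hu, hle⟩ := hBD f
  set u : q.domain := ⟨absEll2 (f : Ell2 μ), hu⟩ with hu_def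
  have h1 := QuadForm.re_resolvent_eq hf f
  have h2 := QuadForm.re_resolvent_eq hf u
  have h3 := QuadForm.norm_sub_sq_complex (f : Ell2 μ) (u : Ell2 μ)
  have h4 : ‖(u : Ell2 μ)‖ = ‖(f : Ell2 μ)‖ := norm_absEll2 _
  rw [QuadForm.re_inner_self, ← QuadForm.val] at h1
  have h5 := hq (f - u)
  rw [QuadForm.val_sub, Submodule.coe_sub] at h5
  have h6 : (inner ℂ (φ : Ell2 μ) (f : Ell2 μ)).re ≤ (inner ℂ (φ : Ell2 μ) (u : Ell2 μ)).re := by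
    refine hasSum_le (fun x => ?_) (Complex.hasSum_re (ell2_hasSum_inner hμ _ _))
      (Complex.hasSum_re (ell2_hasSum_inner hμ _ _))
    have h7 : (u : Ell2 μ) x = ((‖(f : Ell2 μ) x‖ : ℝ) : ℂ) := absEll2_apply hμ _ x
    rw [h7, hφ, Complex.conj_ofReal, Complex.re_mul_ofReal, Complex.re_mul_ofReal,
      Complex.re_ofReal_mul, Complex.re_ofReal_mul, Complex.ofReal_re]
    have := Complex.re_le_norm ((f : Ell2 μ) x)
    have := (hμ x).le
    gcongr
  have h7 : (α + C) * ‖(f : Ell2 μ) - u‖ ^ 2 ≤ 0 := by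
    rw [h4] at h3
    have := mul_le_mul_of_nonneg_left h6 hα0
    rw [h3] at *
    linarith
  have h8 : ‖(f : Ell2 μ) - u‖ ^ 2 = 0 :=
    le_antisymm (nonpos_of_mul_nonpos_right h7 hα) (sq_nonneg _)
  have h9 : (f : Ell2 μ) - u = 0 := by simpa using h8
  exact (sub_eq_zero.1 h9).symm

end

/-! ### The Schrödinger form on finitely supported functions -/

section Form

variable {X : Type*}

/-- The weighted vertex degree. -/
noncomputable def WeightedGraph.degree (b : WeightedGraph X) (x : X) : ℝ := ∑' y, b.weight x y

variable (b : WeightedGraph X) (μ V : X → ℝ)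

theorem hasSum_weight_mul_fst (φ : X → ℝ) (s : Finset X) (hs : ∀ x ∉ s, φ x = 0) :
    HasSum (fun p : X × X => b.weight p.1 p.2 * φ p.1 ^ 2) (∑ x ∈ s, b.degree x * φ x ^ 2) := by
  have h1 : ∀ x, HasSum (fun y => b.weight x y * φ x ^ 2) (b.degree x * φ x ^ 2) := fun x =>
    (b.summable_weight x).hasSum.mul_right _
  have h2 : HasSum (fun x => b.degree x * φ x ^ 2) (∑ x ∈ s, b.degree x * φ x ^ 2) :=
    hasSum_sum_of_ne_finset_zero fun x hx => by simp [hs x hx]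
  have h3 : Summable fun p : X × X => b.weight p.1 p.2 * φ p.1 ^ 2 := by
    rw [summable_prod_of_nonneg fun p => mul_nonneg (b.weight_nonneg _ _) (sq_nonneg _)]
    refine ⟨fun x => (h1 x).summable, ?_⟩
    simpa only [(h1 _).tsum_eq] using h2.summable
  have h4 := h3.hasSum.prod_fiberwise h1
  rw [← h4.unique h2]
  exact h3.hasSum

theorem hasSum_weight_mul_snd (φ : X → ℝ) (s : Finset X) (hs : ∀ x ∉ s, φ x = 0) :
    HasSum (fun p : X × X => b.weight p.1 p.2 * φ p.2 ^ 2) (∑ x ∈ s, b.degree x * φ x ^ 2) := by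
  rw [← (Equiv.prodComm X X).hasSum_iff]
  refine (hasSum_weight_mul_fst b φ s hs).congr_fun fun p => ?_
  simp [b.weight_symm p.2 p.1]

theorem hasSum_weight_mul_sub_sq (φ : X → ℝ) (s : Finset X) (hs : ∀ x ∉ s, φ x = 0) :
    HasSum (fun p : X × X => b.weight p.1 p.2 * (φ p.1 - φ p.2) ^ 2)
      (2 * (∑ x ∈ s, b.degree x * φ x ^ 2 - ∑ x ∈ s, ∑ y ∈ s, b.weight x y * φ x * φ y)) := by
  have h : HasSum (fun p : X × X => b.weight p.1 p.2 * φ p.1 * φ p.2)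
      (∑ p ∈ s ×ˢ s, b.weight p.1 p.2 * φ p.1 * φ p.2) := by
    refine hasSum_sum_of_ne_finset_zero fun p hp => ?_
    rw [Finset.mem_product, not_and_or] at hp
    rcases hp with hp | hp <;> simp [hs _ hp]
  simp only [Finset.sum_product] at h
  have h2 := ((hasSum_weight_mul_fst b φ s hs).add (hasSum_weight_mul_snd b φ s hs)).sub
    (h.mul_left 2)
  rw [mul_sub, two_mul]
  exact h2.congr_fun fun p => by ring

/-- Edges leaving `s` enter only through the degree, so the form becomes a finite sum, suited to
pointwise limits and to matrices. -/
theorem schrodingerForm_ofReal (φ : X → ℝ) (s : Finset X) (hs : ∀ x ∉ s, φ x = 0) :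
    schrodingerForm b μ V (fun x => (φ x : ℂ)) =
      ∑ x ∈ s, (b.degree x + V x * μ x) * φ x ^ 2 -
        ∑ x ∈ s, ∑ y ∈ s, b.weight x y * φ x * φ y := by
  have h1 : ∀ p : X × X, ‖(φ p.1 : ℂ) - φ p.2‖ ^ 2 = (φ p.1 - φ p.2) ^ 2 := fun p => by
    rw [← Complex.ofReal_sub, Complex.norm_real, Real.norm_eq_abs, sq_abs]
  have h2 : ∀ x, V x * ‖(φ x : ℂ)‖ ^ 2 * μ x = V x * μ x * φ x ^ 2 := fun x => by
    rw [Complex.norm_real, Real.norm_eq_abs, sq_abs]; ring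
  simp only [schrodingerForm, h1, h2, (hasSum_weight_mul_sub_sq b φ s hs).tsum_eq]
  rw [tsum_eq_sum (s := s) fun x hx => by simp [hs x hx]]
  simp only [add_mul, Finset.sum_add_distrib]
  ring

theorem schrodingerForm_norm_le (f : X → ℂ) (hf : (Function.support f).Finite) :
    schrodingerForm b μ V (fun x => ((‖f x‖ : ℝ) : ℂ)) ≤ schrodingerForm b μ V f := by
  have hs : ∀ x ∉ hf.toFinset, ‖f x‖ = 0 := fun x hx => by simpa using hx
  have h1 : ∀ p : X × X, b.weight p.1 p.2 * ‖((‖f p.1‖ : ℝ) : ℂ) - ((‖f p.2‖ : ℝ) : ℂ)‖ ^ 2 ≤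
      b.weight p.1 p.2 * ‖f p.1 - f p.2‖ ^ 2 := by
    intro p
    refine mul_le_mul_of_nonneg_left ?_ (b.weight_nonneg _ _)
    rw [← Complex.ofReal_sub, Complex.norm_real]
    exact pow_le_pow_left₀ (norm_nonneg _) (abs_norm_sub_norm_le _ _) 2
  -- Needed for the comparison: a divergent `tsum` would be 0.
  have h2 : Summable fun p : X × X => b.weight p.1 p.2 * ‖f p.1 - f p.2‖ ^ 2 := by
    have h3 := ((hasSum_weight_mul_fst b (fun x => ‖f x‖) _ hs).summable.add
      (hasSum_weight_mul_snd b (fun x => ‖f x‖) _ hs).summable).mul_left 2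
    refine h3.of_nonneg_of_le (fun p => mul_nonneg (b.weight_nonneg _ _) (sq_nonneg _)) fun p => ?_
    have h4 := pow_le_pow_left₀ (norm_nonneg _) (norm_sub_le (f p.1) (f p.2)) 2
    have h5 := mul_le_mul_of_nonneg_left h4 (b.weight_nonneg p.1 p.2)
    nlinarith [mul_nonneg (b.weight_nonneg p.1 p.2) (sq_nonneg (‖f p.1‖ - ‖f p.2‖))]
  have h3 := (h2.of_nonneg_of_le
    (fun p => mul_nonneg (b.weight_nonneg _ _) (sq_nonneg _)) h1).tsum_le_tsum h1 h2
  simp only [schrodingerForm, Complex.norm_real, norm_norm]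
  simp only [← Complex.ofReal_sub, Complex.norm_real] at h3 ⊢
  linarith

end Form

/-! ### Realizations require admissible potentials -/

section Necessity

variable {X : Type*} {b : WeightedGraph X} {μ V : X → ℝ}

/-- Discarding the nonnegative terms outside `s` leaves finitely many values of `g`, a bound that
survives pointwise limits. -/
theorem mul_formalOperator_le (hμ : ∀ x, 0 < μ x) {g : X → ℝ} (hg : ∀ x, 0 ≤ g x)
    (hd : (fun x => (g x : ℂ)) ∈ formalDomain b) (s : Finset X) (x : X) :
    ∃ a : ℝ, formalOperator b μ V (fun x => (g x : ℂ)) x = a ∧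
      a * μ x ≤ (b.degree x + V x * μ x) * g x - ∑ y ∈ s, b.weight x y * g y := by
  have h1 : Summable fun y => b.weight x y * g y := by
    simpa [abs_of_nonneg (hg _)] using hd x
  have h2 := ((b.summable_weight x).mul_right (g x)).hasSum.sub h1.hasSum
  refine ⟨1 / μ x * ∑' y, b.weight x y * (g x - g y) + V x * g x, ?_, ?_⟩
  · simp only [formalOperator]
    push_cast
    rfl
  · have h3 : ∑' y, b.weight x y * (g x - g y) =
        b.degree x * g x - ∑' y, b.weight x y * g y := by
      simp only [mul_sub, h2.tsum_eq, tsum_mul_right]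
      rfl
    have h4 := h1.sum_le_tsum s fun y _ => mul_nonneg (b.weight_nonneg x y) (hg y)
    rw [h3]
    have := (hμ x).ne'
    field_simp
    linarith

variable [Countable X] [MeasurableSpace X] [DiscreteMeasurableSpace X]

theorem IsRealizationWithForm.le_schrodingerForm_of_nonneg (hμ : ∀ x, 0 < μ x)
    {H : Ell2 μ →ₗ.[ℂ] Ell2 μ} {q : QuadForm (Ell2 μ)} (hR : IsRealizationWithForm b μ V H q)
    (hBD : q.FirstBeurlingDeny) {C : ℝ} (hC : C ≤ 0)
    (hq : ∀ f : q.domain, C * ‖(f : Ell2 μ)‖ ^ 2 ≤ q.val f) {φ : Ell2 μ}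
    (hfin : (Function.support φ).Finite) (hφ : ∀ x, φ x = ((‖φ x‖ : ℝ) : ℂ)) :
    C * ‖φ‖ ^ 2 ≤ schrodingerForm b μ V φ := by
  set s := hfin.toFinset with hs_def
  have hs : ∀ x ∉ s, φ x = 0 := fun x hx => by simpa [hs_def] using hx
  have hφd := hR.mem_form_domain φ hfin
  -- Chosen so that `α n + 2 * C = n + 1`, while `α n + C > 0` because `C ≤ 0`.
  set α : ℕ → ℝ := fun n => n + 1 - 2 * C with hα_def
  have hα0 : ∀ n, 0 ≤ α n := fun n => by 
    have : (0 : ℝ) ≤ n := n.cast_nonneg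
    simp only [hα_def]; linarith
  have hα1 : ∀ n, 0 < α n + C := fun n => by
    have : (0 : ℝ) ≤ n := n.cast_nonneg
    simp only [hα_def]; linarith
  choose f hf using fun n => q.exists_resolvent hR.isFormOf.closed hq
    (α := α n) (by linarith [hα1 n]) ((α n : ℂ) • φ)
  have habs : ∀ n, absEll2 (f n : Ell2 μ) = f n := fun n =>
    resolvent_eq_abs hμ (φ := ⟨φ, hφd⟩) hBD hq (hα0 n) (hα1 n) hφ (hf n)
  set g : ℕ → X → ℝ := fun n x => ‖(f n : Ell2 μ) x‖ with hg_def
  have hfg : ∀ n x, (f n : Ell2 μ) x = (g n x : ℂ) := fun n x => by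
    conv_lhs => rw [← habs n]
    exact absEll2_apply hμ _ x
  have hlim : Tendsto (fun n => (f n : Ell2 μ)) atTop (𝓝 φ) := by
    rw [tendsto_iff_norm_sub_tendsto_zero]
    have h1 : ∀ n, ‖(f n : Ell2 μ) - φ‖ ^ 2 ≤
        (q.val ⟨φ, hφd⟩ - 2 * C * ‖φ‖ ^ 2) * (1 / ((n : ℝ) + 1)) := fun n => by
      have h2 := QuadForm.norm_resolvent_sub_sq_le (φ := ⟨φ, hφd⟩) hq hC (hα1 n).le (hf n)
      have h3 : α n + 2 * C = n + 1 := by simp [hα_def]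
      rw [h3] at h2
      rw [mul_one_div, le_div_iff₀ (by positivity), mul_comm]
      exact h2
    have h2 := tendsto_one_div_add_atTop_nhds_zero_nat (𝕜 := ℝ) |>.const_mul
      (q.val ⟨φ, hφd⟩ - 2 * C * ‖φ‖ ^ 2)
    rw [mul_zero] at h2
    have h3 := (squeeze_zero (fun n => sq_nonneg _) h1 h2).sqrt
    simpa using h3
  have hglim : ∀ x, Tendsto (fun n => g n x) atTop (𝓝 ‖φ x‖) := fun x =>
    (((continuous_apply_ell2 hμ x).tendsto φ).comp hlim).norm
  have key : ∀ n, C * ‖(f n : Ell2 μ)‖ ^ 2 ≤ ∑ x ∈ s, ‖φ x‖ *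
      ((b.degree x + V x * μ x) * g n x - ∑ y ∈ s, b.weight x y * g n y) := by
    intro n
    have h1 := QuadForm.resolvent_lower_bound (φ := ⟨φ, hφd⟩) hq (hα0 n) (hf n)
    have h2 : ((f n : Ell2 μ), (α n : ℂ) • φ - (α n : ℂ) • (f n : Ell2 μ)) ∈ H.graph := by
      refine (hR.isFormOf.mem_graph_iff _ _).2 ⟨(f n).2, fun h => ?_⟩
      rw [inner_sub_left, ← hf n h, inner_smul_left, Complex.conj_ofReal, add_sub_cancel_right]
    have h3 := LinearPMap.mem_domain_of_mem_graph h2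
    obtain ⟨_, h4⟩ := hR.isFormOf.apply_sesq ⟨(f n : Ell2 μ), h3⟩
    have h5 : q.sesq (f n) ⟨φ, hφd⟩ = _ := h4 ⟨φ, hφd⟩
    have hfun : ((f n : Ell2 μ) : X → ℂ) = fun x => (g n x : ℂ) := funext (hfg n)
    have hd : (fun x => (g n x : ℂ)) ∈ formalDomain b := by
      rw [← hfun]
      exact hR.mem_formalDomain ⟨(f n : Ell2 μ), h3⟩
    refine h1.trans ?_
    rw [h5, ell2_inner_eq_sum hμ _ _ hs, Complex.re_sum]
    refine Finset.sum_le_sum fun x _ => ?_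
    obtain ⟨a, ha, hle⟩ := mul_formalOperator_le (V := V) hμ (fun x => norm_nonneg _) hd s x
    rw [hR.eq_formalOperator]
    simp only [hfun]
    rw [ha, Complex.conj_ofReal]
    nth_rewrite 1 [hφ x]
    rw [← Complex.ofReal_mul, ← Complex.ofReal_mul,
      Complex.ofReal_re]
    have := mul_le_mul_of_nonneg_left hle (norm_nonneg (φ x))
    linarith
  have hform : schrodingerForm b μ V φ = ∑ x ∈ s, ‖φ x‖ *
      ((b.degree x + V x * μ x) * ‖φ x‖ - ∑ y ∈ s, b.weight x y * ‖φ y‖) := by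
    have h1 := schrodingerForm_ofReal b μ V (fun x => ‖φ x‖) s fun x hx => by simp [hs x hx]
    have h2 : (φ : X → ℂ) = fun x => ((‖φ x‖ : ℝ) : ℂ) := funext hφ
    rw [← h2] at h1
    rw [h1, ← Finset.sum_sub_distrib]
    refine Finset.sum_congr rfl fun x _ => ?_
    rw [mul_sub, Finset.mul_sum]
    congr 1
    · ring
    · exact Finset.sum_congr rfl fun y _ => by ring
  rw [hform]
  refine le_of_tendsto_of_tendsto' ((hlim.norm.pow 2).const_mul C) ?_ key
  exact tendsto_finsetSum _ fun x _ => (((hglim x).const_mul _).sub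
    (tendsto_finsetSum _ fun y _ => (hglim y).const_mul _)).const_mul _

theorem IsRealizationWithForm.admissible (hμ : ∀ x, 0 < μ x)
    {H : Ell2 μ →ₗ.[ℂ] Ell2 μ} {q : QuadForm (Ell2 μ)} (hR : IsRealizationWithForm b μ V H q)
    (hBD : q.FirstBeurlingDeny) : Admissible b μ V := by
  obtain ⟨C, hC⟩ := hR.isFormOf.lowerSemibounded
  refine ⟨min C 0, fun φ hφ => ?_⟩
  have h1 := hR.le_schrodingerForm_of_nonneg hμ hBD (min_le_right C 0)
    (fun f => (mul_le_mul_of_nonneg_right (min_le_left C 0) (sq_nonneg _)).trans (hC f))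
    (φ := absEll2 φ) (by rwa [support_absEll2 hμ]) (fun x => by simp [absEll2_apply hμ])
  have h2 : (absEll2 φ : X → ℂ) = fun x => ((‖φ x‖ : ℝ) : ℂ) := funext (absEll2_apply hμ φ)
  rw [norm_absEll2, h2] at h1
  exact h1.trans (schrodingerForm_norm_le b μ V φ hφ)

end Necessity

/-! ### Positive supersolutions -/

section Supersolution

/-- Solvability of `(d - b) h = g m` by a nonnegative function on a finite set, if the symmetric
matrix `d - b` is bounded from below by the diagonal matrix `m`, and `b` and `g` are nonnegative. -/
theorem exists_nonneg_solution {ι : Type*} [Fintype ι] {d m g : ι → ℝ} {b : ι → ι → ℝ}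
    (hb : ∀ x y, 0 ≤ b x y) (hm : ∀ x, 0 < m x) (hg : ∀ x, 0 ≤ g x)
    (hpos : ∀ u : ι → ℝ, ∑ x, m x * u x ^ 2 ≤ ∑ x, u x * (d x * u x - ∑ y, b x y * u y)) :
    ∃ h : ι → ℝ, (∀ x, 0 ≤ h x) ∧ (∀ x, d x * h x - ∑ y, b x y * h y = g x * m x) ∧
      ∑ x, m x * h x ^ 2 ≤ ∑ x, m x * g x ^ 2 := by
  have hzero : ∀ u : ι → ℝ, ∑ x, m x * u x ^ 2 ≤ 0 → ∀ x, u x = 0 := by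
    intro u hu x
    have h1 : ∀ x ∈ Finset.univ, 0 ≤ m x * u x ^ 2 := fun x _ =>
      mul_nonneg (hm x).le (sq_nonneg _)
    have h2 := (Finset.sum_eq_zero_iff_of_nonneg h1).1 (le_antisymm hu (Finset.sum_nonneg h1)) x
      (Finset.mem_univ x)
    simpa [(hm x).ne'] using h2
  let A : (ι → ℝ) →ₗ[ℝ] (ι → ℝ) :=
    { toFun := fun u x => d x * u x - ∑ y, b x y * u y
      map_add' := fun u v => by
        ext x
        simp only [Pi.add_apply, mul_add, Finset.sum_add_distrib]
        ring
      map_smul' := fun c u => by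
        ext x
        simp only [Pi.smul_apply, smul_eq_mul, RingHom.id_apply, mul_sub, Finset.mul_sum]
        congr 1
        · ring
        · exact Finset.sum_congr rfl fun y _ => by ring }
  have hA : ∀ u x, A u x = d x * u x - ∑ y, b x y * u y := fun _ _ => rfl
  have hinj : Function.Injective A := by
    rw [injective_iff_map_eq_zero]
    intro u hu
    funext x
    refine hzero u ((hpos u).trans_eq ?_) x
    simp only [← hA, hu, Pi.zero_apply, mul_zero, Finset.sum_const_zero]
  obtain ⟨h, hh⟩ := LinearMap.injective_iff_surjective.1 hinj fun x => g x * m x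
  have hsol : ∀ x, d x * h x - ∑ y, b x y * h y = g x * m x := fun x => congrFun hh x
  -- Minimum principle: where `h < 0`, the negative part `h⁻` satisfies `(d - b) h⁻ = -g m - b h⁺ ≤
  -- 0`, so testing with `h⁻` contradicts positivity unless `h⁻ = 0`.
  have hneg : ∀ x, max (-h x) 0 = 0 := by
    refine hzero _ ((hpos _).trans ?_)
    refine Finset.sum_nonpos fun x _ => ?_
    have h1 : ∑ y, b x y * max (h y) 0 - ∑ y, b x y * max (-h y) 0 = ∑ y, b x y * h y := by
      rw [← Finset.sum_sub_distrib]
      refine Finset.sum_congr rfl fun y _ => ?_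
      rw [← mul_sub]
      congr 1
      rcases le_total 0 (h y) with hy | hy
      · rw [max_eq_left hy, max_eq_right (by linarith)]; ring
      · rw [max_eq_right hy, max_eq_left (by linarith)]; ring
    have h2 : 0 ≤ ∑ y, b x y * max (h y) 0 := Finset.sum_nonneg fun y _ =>
      mul_nonneg (hb x y) (le_max_right _ _)
    have h3 := hsol x
    have h4 := mul_nonneg (hg x) (hm x).le
    rcases le_total 0 (h x) with hx | hx
    · rw [max_eq_right (by linarith : -h x ≤ 0)]; simp
    · rw [max_eq_left (by linarith : 0 ≤ -h x)]
      exact mul_nonpos_of_nonneg_of_nonpos (by linarith) (by linarith)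
  refine ⟨h, fun x => by have := hneg x; rw [max_eq_right_iff] at this; linarith, hsol, ?_⟩
  have h1 := hpos h
  -- Young's inequality for `h g m`; half of `∑ m h²` is then absorbed.
  have h2 : ∑ x, h x * (d x * h x - ∑ y, b x y * h y) ≤
      ∑ x, (1 / 2 * (m x * h x ^ 2) + 1 / 2 * (m x * g x ^ 2)) := by
    refine Finset.sum_le_sum fun x _ => ?_
    rw [hsol x]
    nlinarith [mul_nonneg (hm x).le (sq_nonneg (h x - g x))]
  rw [Finset.sum_add_distrib, ← Finset.mul_sum, ← Finset.mul_sum] at h2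
  linarith

variable {X : Type*} [Countable X] [MeasurableSpace X] [DiscreteMeasurableSpace X]
  {b : WeightedGraph X} {μ V : X → ℝ}

/-- Lowering the constant to `C - 1` leaves a spectral gap 1, so the matrix on `s` dominates `diag
μ`. This gives solvability and bounds on `h` that do not depend on `s`. -/
theorem exists_supersolution_on_finset (hμ : ∀ x, 0 < μ x) {C : ℝ}
    (hC : ∀ φ : Ell2 μ, (Function.support φ).Finite → C * ‖φ‖ ^ 2 ≤ schrodingerForm b μ V φ)
    {g : X → ℝ} (hg : ∀ x, 0 ≤ g x) (s : Finset X) (hgs : ∑ x ∈ s, μ x * g x ^ 2 ≤ 1) :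
    ∃ h : X → ℝ, (∀ x, 0 ≤ h x) ∧ (∀ x, μ x * h x ^ 2 ≤ 1) ∧ ∀ x ∈ s,
      (b.degree x + (V x - (C - 1)) * μ x) * h x - ∑ y ∈ s, b.weight x y * h y = g x * μ x := by
  classical
  let ext : (s → ℝ) → X → ℝ := fun u x => if hx : x ∈ s then u ⟨x, hx⟩ else 0
  have ext_coe : ∀ u (x : s), ext u x = u x := fun u x => by simp [ext]
  have ext_zero : ∀ u, ∀ x ∉ s, ext u x = 0 := fun u x hx => by simp [ext, hx]
  obtain ⟨h, h0, hsol, hle⟩ := exists_nonneg_solution (ι := s)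
    (d := fun x => b.degree x + (V x - (C - 1)) * μ x) (m := fun x => μ x) (g := fun x => g x)
    (b := fun x y => b.weight x y) (fun x y => b.weight_nonneg x y) (fun x => hμ x)
    (fun x => hg x) (by
      intro u
      set r := ext u with hr
      have hfin : (Function.support fun x => (r x : ℂ)).Finite :=
        s.finite_toSet.subset fun x hx => by
          by_contra hxs
          exact hx (by simp [hr, ext_zero u x hxs])
      set φ := ell2OfFiniteSupport μ _ hfin with hφ_def
      have hφ : (φ : X → ℂ) = fun x => (r x : ℂ) := funext (ell2OfFiniteSupport_apply hμ _ hfin)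
      have h1 := hC φ (by rw [hφ]; exact hfin)
      rw [hφ, schrodingerForm_ofReal b μ V r s (ext_zero u),
        ell2_norm_sq_eq_sum hμ φ (s := s) (fun x hx => by simp [hφ, hr, ext_zero u x hx])] at h1
      simp only [hφ, Complex.norm_real, Real.norm_eq_abs, sq_abs] at h1
      have h2 : ∑ x : s, μ x * u x ^ 2 = ∑ x ∈ s, r x ^ 2 * μ x := by
        rw [← Finset.sum_coe_sort s]
        exact Finset.sum_congr rfl fun x _ => by rw [hr, ext_coe]; ring
      have h3 : ∑ x : s, u x * ((b.degree x + (V x - (C - 1)) * μ x) * u x -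
          ∑ y : s, b.weight x y * u y) = ∑ x ∈ s, (b.degree x + V x * μ x) * r x ^ 2 -
            ∑ x ∈ s, ∑ y ∈ s, b.weight x y * r x * r y - (C - 1) * ∑ x ∈ s, r x ^ 2 * μ x := by
        rw [Finset.mul_sum, ← Finset.sum_sub_distrib, ← Finset.sum_sub_distrib,
          ← Finset.sum_coe_sort s]
        refine Finset.sum_congr rfl fun x _ => ?_
        have h4 : u x * ∑ y : s, b.weight x y * u y = ∑ y ∈ s, b.weight x y * r x * r y := by
          rw [Finset.mul_sum, ← Finset.sum_coe_sort s]
          exact Finset.sum_congr rfl fun y _ => by rw [hr, ext_coe, ext_coe]; ring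
        rw [mul_sub, h4, hr, ext_coe]
        ring
      rw [h2, h3]
      linarith)
  have h1 : ∑ x : s, μ x * g x ^ 2 ≤ 1 := by
    rwa [Finset.sum_coe_sort s fun x => μ x * g x ^ 2]
  refine ⟨ext h, fun x => ?_, fun x => ?_, fun x hx => ?_⟩
  · by_cases hx : x ∈ s
    · exact (h0 ⟨x, hx⟩).trans_eq (ext_coe h ⟨x, hx⟩).symm
    · rw [ext_zero h x hx]
  · by_cases hx : x ∈ s
    · rw [show ext h x = h ⟨x, hx⟩ from ext_coe h ⟨x, hx⟩]
      exact (Finset.single_le_sum (f := fun x : s => μ x * h x ^ 2)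
        (fun y _ => mul_nonneg (hμ y).le (sq_nonneg _))
        (Finset.mem_univ (⟨x, hx⟩ : s))).trans (hle.trans h1)
    · simp [ext_zero h x hx]
  · rw [show ext h x = h ⟨x, hx⟩ from ext_coe h ⟨x, hx⟩, ← hsol ⟨x, hx⟩]
    congr 1
    rw [← Finset.sum_coe_sort s]
    exact Finset.sum_congr rfl fun y _ => by rw [ext_coe]

/-- An admissible potential has a strictly positive supersolution. -/
theorem Admissible.exists_supersolution (hμ : ∀ x, 0 < μ x) (hV : Admissible b μ V) :
    ∃ (c : ℝ) (h : X → ℝ), (∀ x, 0 < h x) ∧ (∀ x, Summable fun y => b.weight x y * h y) ∧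
      ∀ x, ∑' y, b.weight x y * h y ≤ (b.degree x + (V x - c) * μ x) * h x := by
  obtain ⟨C, hC⟩ := hV
  -- The right-hand side `g` is strictly positive everywhere, yet `∑ μ g² = ∑ ε < 1`.
  obtain ⟨ε, hε, a, hεa, ha⟩ := NNReal.exists_pos_sum_of_countable one_ne_zero X
  set g : X → ℝ := fun x => √(ε x / μ x) with hg_def
  have hε' : ∀ x, 0 < (ε x : ℝ) / μ x := fun x => div_pos (hε x) (hμ x)
  have hg : ∀ x, 0 < g x := fun x => Real.sqrt_pos.2 (hε' x)
  have hgs : ∀ s : Finset X, ∑ x ∈ s, μ x * g x ^ 2 ≤ 1 := by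
    intro s
    have h1 : ∀ x, μ x * g x ^ 2 = ε x := fun x => by
      rw [hg_def, Real.sq_sqrt (hε' x).le, mul_div_cancel₀ _ (hμ x).ne']
    simp only [h1]
    have h2 := sum_le_hasSum s (fun _ _ => zero_le) hεa
    exact_mod_cast h2.trans ha.le
  choose h h0 hle hsol using fun s =>
    exists_supersolution_on_finset hμ hC (fun x => (hg x).le) s (hgs s)
  have hcpt : IsCompact (Set.univ.pi fun x => Set.Icc (0 : ℝ) √(1 / μ x)) :=
    isCompact_univ_pi fun x => isCompact_Icc
  have hmem : ∀ s, h s ∈ Set.univ.pi fun x => Set.Icc (0 : ℝ) √(1 / μ x) := by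
    intro s x _
    refine ⟨h0 s x, Real.le_sqrt_of_sq_le ?_⟩
    rw [le_div_iff₀ (hμ x), mul_comm]
    exact hle s x
  let U : Ultrafilter (Finset X) := Ultrafilter.of atTop
  have hU : (U : Filter (Finset X)) ≤ atTop := Ultrafilter.of_le atTop
  obtain ⟨w, _, hw⟩ := hcpt.ultrafilter_le_nhds (U.map h) (by
    rw [le_principal_iff]
    exact Filter.mem_map.2 (Filter.univ_mem' hmem))
  have hlim : ∀ x, Tendsto (fun s => h s x) U (𝓝 (w x)) := fun x =>
    ((continuous_apply x).tendsto w).comp (show Tendsto h U (𝓝 w) from hw)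
  have hw0 : ∀ x, 0 ≤ w x := fun x => ge_of_tendsto' (hlim x) fun s => h0 s x
  -- Fatou-type argument: `F` is fixed before the limit, and for `s ⊇ F ∪ {x}` the sum over `s` only
  -- gets smaller when restricted to `F`.
  have hfin : ∀ x (F : Finset X), ∑ y ∈ F, b.weight x y * w y ≤
      (b.degree x + (V x - (C - 1)) * μ x) * w x - g x * μ x := by
    classical
    intro x F
    refine le_of_tendsto_of_tendsto
      (tendsto_finsetSum F fun y _ => (hlim y).const_mul (b.weight x y))
      (((hlim x).const_mul _).sub_const _) ?_
    filter_upwards [hU (eventually_ge_atTop (insert x F))] with s hs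
    have h1 := hsol s x (hs (Finset.mem_insert_self x F))
    have h2 : ∑ y ∈ F, b.weight x y * h s y ≤ ∑ y ∈ s, b.weight x y * h s y :=
      Finset.sum_le_sum_of_subset_of_nonneg ((Finset.subset_insert x F).trans hs)
        fun y _ _ => mul_nonneg (b.weight_nonneg x y) (h0 s y)
    linarith
  refine ⟨C - 1, w, fun x => ?_, fun x => ?_, fun x => ?_⟩
  -- With `F = ∅`, a zero of `w` at `x` would give `0 ≤ -g x * μ x`.
  · refine lt_of_le_of_ne (hw0 x) fun hx => ?_
    have h1 := hfin x ∅
    rw [← hx, Finset.sum_empty] at h1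
    linarith [mul_pos (hg x) (hμ x)]
  · exact summable_of_sum_le (fun y => mul_nonneg (b.weight_nonneg x y) (hw0 y)) (hfin x)
  · refine Real.tsum_le_of_sum_le (fun y => mul_nonneg (b.weight_nonneg x y) (hw0 y)) fun F => ?_
    linarith [hfin x F, mul_pos (hg x) (hμ x)]

end Supersolution

/-! ### The form given by a supersolution -/

section Sufficiency

theorem memℓp_two_iff {ι : Type*} {f : ι → ℂ} : Memℓp f 2 ↔ Summable fun i => ‖f i‖ ^ 2 := by
  rw [memℓp_gen_iff (by simp)]
  simp

variable {X : Type*}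

/-- The weighted graph with weights `b x y * w x * w y`. -/
def WeightedGraph.transform (b : WeightedGraph X) (w : X → ℝ) (hw : ∀ x, 0 < w x)
    (hs : ∀ x, Summable fun y => b.weight x y * w y) : WeightedGraph X where
  weight x y := w x * (b.weight x y * w y)
  weight_nonneg x y := mul_nonneg (hw x).le (mul_nonneg (b.weight_nonneg x y) (hw y).le)
  weight_self x := by simp [b.weight_self]
  weight_symm x y := by rw [b.weight_symm x y]; ring
  summable_weight x := (hs x).mul_left _

variable [MeasurableSpace X] [DiscreteMeasurableSpace X] {μ : X → ℝ}

/-- The functionals `√(b x y / 2) (f x / w x - f y / w y)` and `√(k x) f x`. -/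
noncomputable def gradientMap (hμ : ∀ x, 0 < μ x) (b : WeightedGraph X) (w k : X → ℝ) :
    Ell2 μ →ₗ[ℂ] ((X × X) ⊕ X → ℂ) :=
  LinearMap.pi (Sum.elim
    (fun p => ((√(b.weight p.1 p.2 / 2) : ℝ) : ℂ) • (((w p.1)⁻¹ : ℂ) • evalEll2 hμ p.1 -
      ((w p.2)⁻¹ : ℂ) • evalEll2 hμ p.2))
    (fun x => ((√(k x) : ℝ) : ℂ) • evalEll2 hμ x))

variable {b : WeightedGraph X} {w k : X → ℝ}

theorem gradientMap_inl (hμ : ∀ x, 0 < μ x) (f : Ell2 μ) (p : X × X) :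
    gradientMap hμ b w k f (Sum.inl p) = ((√(b.weight p.1 p.2 / 2) : ℝ) : ℂ) *
      ((w p.1 : ℂ)⁻¹ * f p.1 - (w p.2 : ℂ)⁻¹ * f p.2) := by
  simp [gradientMap, evalEll2_apply]

theorem gradientMap_inr (hμ : ∀ x, 0 < μ x) (f : Ell2 μ) (x : X) :
    gradientMap hμ b w k f (Sum.inr x) = ((√(k x) : ℝ) : ℂ) * f x := by
  simp [gradientMap, evalEll2_apply]

theorem norm_gradientMap_inl_sq (hμ : ∀ x, 0 < μ x) (f : Ell2 μ) (p : X × X) :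
    ‖gradientMap hμ b w k f (Sum.inl p)‖ ^ 2 = b.weight p.1 p.2 / 2 *
      ‖(w p.1 : ℂ)⁻¹ * f p.1 - (w p.2 : ℂ)⁻¹ * f p.2‖ ^ 2 := by
  rw [gradientMap_inl, norm_mul, mul_pow, Complex.norm_real, Real.norm_eq_abs, sq_abs,
    Real.sq_sqrt (div_nonneg (b.weight_nonneg _ _) zero_le_two)]

/-- Since `w > 0`, `|f|/w = |f/w|`, and the reverse triangle inequality applies to each difference.
-/
theorem norm_gradientMap_abs_le (hμ : ∀ x, 0 < μ x) (hw : ∀ x, 0 < w x) (f : Ell2 μ)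
    (i : (X × X) ⊕ X) :
    ‖gradientMap hμ b w k (absEll2 f) i‖ ≤ ‖gradientMap hμ b w k f i‖ := by
  rcases i with p | x
  · rw [gradientMap_inl, gradientMap_inl, norm_mul, norm_mul]
    refine mul_le_mul_of_nonneg_left ?_ (norm_nonneg _)
    have h1 : ∀ x, (w x : ℂ)⁻¹ * absEll2 f x = ((‖(w x : ℂ)⁻¹ * f x‖ : ℝ) : ℂ) := fun x => by
      rw [absEll2_apply hμ, norm_mul, norm_inv, Complex.norm_real, Real.norm_eq_abs,
        abs_of_pos (hw x)]
      push_cast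
      rfl
    rw [h1, h1, ← Complex.ofReal_sub, Complex.norm_real]
    exact abs_norm_sub_norm_le _ _
  · rw [gradientMap_inr, gradientMap_inr, norm_mul, norm_mul, absEll2_apply hμ,
      Complex.norm_real ‖f x‖, norm_norm]

theorem firstBeurlingDeny_gradientMap (hμ : ∀ x, 0 < μ x) (hw : ∀ x, 0 < w x) (c : ℝ) :
    (QuadForm.ofFunctionals (gradientMap hμ b w k) c).FirstBeurlingDeny := by
  intro f
  have hmem : absEll2 (f : Ell2 μ) ∈ (QuadForm.ofFunctionals (gradientMap hμ b w k) c).domain :=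
    Memℓp.mono' (F := fun _ => ℂ) f.2 (norm_gradientMap_abs_le hμ hw f)
  refine ⟨hmem, ?_⟩
  rw [QuadForm.ofFunctionals_val, QuadForm.ofFunctionals_val, norm_absEll2]
  gcongr
  exact lp.norm_mono (by simp) (norm_gradientMap_abs_le hμ hw f)

theorem continuous_gradientMap [Countable X] (hμ : ∀ x, 0 < μ x) (i : (X × X) ⊕ X) :
    Continuous fun f => gradientMap hμ b w k f i := by
  rcases i with p | x
  · simp only [gradientMap_inl]
    exact continuous_const.mul ((continuous_const.mul (continuous_apply_ell2 hμ _)).sub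
      (continuous_const.mul (continuous_apply_ell2 hμ _)))
  · simp only [gradientMap_inr]
    exact continuous_const.mul (continuous_apply_ell2 hμ _)

/-- Write `A`, `B` for `f/w` at `x`, `y`. Then `|f y| = w y |B|` and `|B| ≤ |A| + 1 + |A - B|²`;
weighted by `b x y * w y`, the constant part is summable by `hs` and the square by finiteness of the
form. -/
theorem mem_formalDomain_of_mem_sqSummableDomain (hμ : ∀ x, 0 < μ x) (hw : ∀ x, 0 < w x)
    (hs : ∀ x, Summable fun y => b.weight x y * w y) {f : Ell2 μ}
    (hf : f ∈ QuadForm.sqSummableDomain (gradientMap hμ (b.transform w hw hs) w k)) :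
    (f : X → ℂ) ∈ formalDomain b := by
  intro x
  have h1 : Summable fun y : X =>
      ‖gradientMap hμ (b.transform w hw hs) w k f (Sum.inl (x, y))‖ ^ 2 :=
    (memℓp_two_iff.1 hf).comp_injective (Sum.inl_injective.comp (Prod.mk_right_injective x))
  have h2 := ((hs x).mul_left (‖(w x : ℂ)⁻¹ * f x‖ + 1)).add (h1.mul_left (2 * (w x)⁻¹))
  refine h2.of_nonneg_of_le (fun y => mul_nonneg (b.weight_nonneg _ _) (norm_nonneg _)) fun y => ?_
  rw [norm_gradientMap_inl_sq]
  simp only [WeightedGraph.transform]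
  set A := (w x : ℂ)⁻¹ * f x
  set B := (w y : ℂ)⁻¹ * f y with hB
  have h3 : ‖f y‖ = w y * ‖B‖ := by
    rw [hB, norm_mul, norm_inv, Complex.norm_real, Real.norm_eq_abs, abs_of_pos (hw y),
      mul_inv_cancel_left₀ (hw y).ne']
  have h4 : ‖B‖ ≤ ‖A‖ + 1 + ‖A - B‖ ^ 2 := by
    have h5 := norm_sub_norm_le B A
    rw [norm_sub_rev] at h5
    nlinarith [sq_nonneg (‖A - B‖ - 1)]
  have h5 := mul_le_mul_of_nonneg_left h4 (mul_nonneg (b.weight_nonneg x y) (hw y).le)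
  have h6 : 2 * (w x)⁻¹ * (w x * (b.weight x y * w y) / 2 * ‖A - B‖ ^ 2) =
      b.weight x y * w y * ‖A - B‖ ^ 2 := by
    have := (hw x).ne'
    field_simp
  rw [h3, h6]
  linarith

variable [Countable X]

theorem deltaEll2_mem_sqSummableDomain [DecidableEq X] (hμ : ∀ x, 0 < μ x) (x : X) :
    deltaEll2 μ x ∈ QuadForm.sqSummableDomain (gradientMap hμ b w k) := by
  refine memℓp_two_iff.2 (Summable.sum _ ?_ ?_)
  · have h1 := (hasSum_weight_mul_sub_sq b (fun y => if y = x then (w y)⁻¹ else 0) {x}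
      fun y hy => if_neg (by simpa using hy)).summable.mul_left (1 / 2)
    refine h1.congr fun p => ?_
    have h2 : ∀ y, (w y : ℂ)⁻¹ * deltaEll2 μ x y =
        ((if y = x then (w y)⁻¹ else 0 : ℝ) : ℂ) := fun y => by
      rw [deltaEll2_apply hμ]; split_ifs <;> simp
    rw [Function.comp_apply, norm_gradientMap_inl_sq, h2, h2, ← Complex.ofReal_sub,
      Complex.norm_real, Real.norm_eq_abs, sq_abs]
    ring
  · refine summable_of_ne_finset_zero (s := {x}) fun y hy => ?_
    rw [Function.comp_apply, gradientMap_inr, deltaEll2_apply hμ, if_neg (by simpa using hy)]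
    simp

theorem inner_toEll2_deltaEll2 [DecidableEq X] (hμ : ∀ x, 0 < μ x) (hk : ∀ x, 0 ≤ k x)
    (f : QuadForm.sqSummableDomain (gradientMap hμ b w k)) (x : X) {a : ℂ}
    (ha : HasSum (fun y => (b.weight x y : ℂ) *
      conj ((w x : ℂ)⁻¹ * (f : Ell2 μ) x - (w y : ℂ)⁻¹ * (f : Ell2 μ) y)) a) :
    inner ℂ (QuadForm.toEll2 (gradientMap hμ b w k) f)
        (QuadForm.toEll2 (gradientMap hμ b w k) ⟨_, deltaEll2_mem_sqSummableDomain hμ x⟩) =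
      (w x : ℂ)⁻¹ * a + k x * conj ((f : Ell2 μ) x) := by
  refine (lp.hasSum_inner _ _).unique (HasSum.sum ?_ ?_)
  -- Only pairs containing `x` contribute. `G` collects those with first entry `x`, its swap those
  -- with second entry `x`, each giving half; at `(x, x)` the difference vanishes.
  · set G : X × X → ℂ := fun p => if p.1 = x then (w x : ℂ)⁻¹ / 2 * ((b.weight x p.2 : ℂ) *
      conj ((w x : ℂ)⁻¹ * (f : Ell2 μ) x - (w p.2 : ℂ)⁻¹ * (f : Ell2 μ) p.2)) else 0 with hG
    have h1 : HasSum G ((w x : ℂ)⁻¹ / 2 * a) := by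
      rw [← (Prod.mk_right_injective x).hasSum_iff]
      · simpa [hG, Function.comp_def] using ha.mul_left ((w x : ℂ)⁻¹ / 2)
      · rintro ⟨y, z⟩ hyz
        exact if_neg fun h => hyz ⟨z, Prod.ext h.symm rfl⟩
    have h2 : HasSum (fun p : X × X => G p.swap) ((w x : ℂ)⁻¹ / 2 * a) :=
      (Equiv.prodComm X X).hasSum_iff.2 h1
    have h3 := h1.add h2
    rw [← add_mul, add_halves] at h3
    refine h3.congr_fun ?_
    · rintro ⟨y, z⟩
      have hsq : ((√(b.weight y z / 2) : ℝ) : ℂ) * ((√(b.weight y z / 2) : ℝ) : ℂ) =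
          (b.weight y z : ℂ) / 2 := by
        rw [← Complex.ofReal_mul, Real.mul_self_sqrt (div_nonneg (b.weight_nonneg _ _) zero_le_two)]
        push_cast
        rfl
      have h4 : inner ℂ (QuadForm.toEll2 (gradientMap hμ b w k) f (Sum.inl (y, z)))
          (QuadForm.toEll2 (gradientMap hμ b w k) ⟨_, deltaEll2_mem_sqSummableDomain hμ x⟩
            (Sum.inl (y, z))) = (b.weight y z : ℂ) / 2 *
          conj ((w y : ℂ)⁻¹ * (f : Ell2 μ) y - (w z : ℂ)⁻¹ * (f : Ell2 μ) z) *
          ((w y : ℂ)⁻¹ * (if y = x then 1 else 0) - (w z : ℂ)⁻¹ * (if z = x then 1 else 0)) := by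
        rw [RCLike.inner_apply, QuadForm.toEll2_apply, QuadForm.toEll2_apply, gradientMap_inl,
          gradientMap_inl, ← hsq, map_mul, Complex.conj_ofReal, deltaEll2_apply hμ,
          deltaEll2_apply hμ]
        ring
      refine h4.trans ?_
      simp only [hG, Prod.fst_swap, Prod.snd_swap]
      by_cases hy : y = x <;> by_cases hz : z = x
      · subst hy; subst hz; simp
      · subst hy; simp [hz]; ring
      · subst hz; simp [hy, b.weight_symm y z]; ring
      · simp [hy, hz]
  · have h1 := hasSum_single x (f := fun y => (k y : ℂ) * conj ((f : Ell2 μ) y) *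
      (if y = x then 1 else 0)) fun y hy => by simp [hy]
    simp only [if_true, mul_one] at h1
    refine h1.congr_fun fun y => ?_
    have hsq : ((√(k y) : ℝ) : ℂ) * ((√(k y) : ℝ) : ℂ) = (k y : ℂ) := by
      rw [← Complex.ofReal_mul, Real.mul_self_sqrt (hk y)]
    rw [Function.comp_apply, RCLike.inner_apply, QuadForm.toEll2_apply, QuadForm.toEll2_apply,
      gradientMap_inr, gradientMap_inr, ← hsq, map_mul, Complex.conj_ofReal, deltaEll2_apply hμ]
    ring

/-- Green's formula for the form given by a supersolution. -/
theorem sesq_deltaEll2 [DecidableEq X] (hμ : ∀ x, 0 < μ x) (hw : ∀ x, 0 < w x)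
    (hs : ∀ x, Summable fun y => b.weight x y * w y) {V : X → ℝ} {c : ℝ}
    (hk : ∀ x, 0 ≤ k x) (hkw : ∀ x, k x = b.degree x + (V x - c) * μ x -
      (w x)⁻¹ * ∑' y, b.weight x y * w y)
    (f : (QuadForm.ofFunctionals (gradientMap hμ (b.transform w hw hs) w k) c).domain) (x : X) :
    (QuadForm.ofFunctionals (gradientMap hμ (b.transform w hw hs) w k) c).sesq f
        ⟨_, deltaEll2_mem_sqSummableDomain hμ x⟩ =
      conj (formalOperator b μ V (f : Ell2 μ) x) * μ x := by
  have hfd := mem_formalDomain_of_mem_sqSummableDomain hμ hw hs f.2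
  have hsum : HasSum (fun y => (b.weight x y : ℂ) * (f : Ell2 μ) y)
      (∑' y, (b.weight x y : ℂ) * (f : Ell2 μ) y) := by
    refine (Summable.of_norm ((hfd x).congr fun y => ?_)).hasSum
    rw [norm_mul, Complex.norm_real, Real.norm_eq_abs, abs_of_nonneg (b.weight_nonneg x y)]
  set B := ∑' y, (b.weight x y : ℂ) * (f : Ell2 μ) y
  have hdeg : HasSum (fun y => (b.weight x y : ℂ)) (b.degree x : ℂ) :=
    Complex.hasSum_ofReal.2 (b.summable_weight x).hasSum
  have hS : HasSum (fun y => ((b.weight x y * w y : ℝ) : ℂ))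
      ((∑' y, b.weight x y * w y : ℝ) : ℂ) := Complex.hasSum_ofReal.2 (hs x).hasSum
  have hformal : formalOperator b μ V (f : Ell2 μ) x =
      1 / μ x * (b.degree x * (f : Ell2 μ) x - B) + V x * (f : Ell2 μ) x := by
    simp only [formalOperator, mul_sub, ((hdeg.mul_right ((f : Ell2 μ) x)).sub hsum).tsum_eq]
  have hwx : ∀ x, (w x : ℂ) ≠ 0 := fun x => Complex.ofReal_ne_zero.2 (hw x).ne'
  have hμx : (μ x : ℂ) ≠ 0 := Complex.ofReal_ne_zero.2 (hμ x).ne'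
  -- Clearing denominators, `w x * w y * (f x / w x - f y / w y) = w y * f x - w x * f y`, which
  -- splits the sum into two convergent ones.
  have ha : HasSum (fun y => ((b.transform w hw hs).weight x y : ℂ) *
      conj ((w x : ℂ)⁻¹ * (f : Ell2 μ) x - (w y : ℂ)⁻¹ * (f : Ell2 μ) y))
      (((∑' y, b.weight x y * w y : ℝ) : ℂ) * conj ((f : Ell2 μ) x) - w x * conj B) := by
    have h1 := (hS.mul_right (conj ((f : Ell2 μ) x))).sub
      ((Complex.hasSum_conj'.2 (by simpa using hsum) :
        HasSum (fun y => conj ((b.weight x y : ℂ) * (f : Ell2 μ) y)) (conj B)).mul_left (w x : ℂ))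
    refine h1.congr_fun fun y => ?_
    have := hwx x
    have := hwx y
    simp only [WeightedGraph.transform, map_sub, map_mul, map_inv₀, Complex.conj_ofReal]
    push_cast
    field_simp
  rw [QuadForm.ofFunctionals_sesq, inner_deltaEll2 hμ, hformal]
  refine (congrArg (· + _) (inner_toEll2_deltaEll2 hμ hk f x ha)).trans ?_
  -- The term with `∑' y, b.weight x y * w y` cancels against the one in `k`, and `c` against the
  -- shift in `k`.
  simp only [hkw]
  have := hwx x
  simp only [map_add, map_mul, map_sub, map_div₀, map_one, Complex.conj_ofReal]
  push_cast
  field_simp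
  ring

theorem Admissible.exists_realization (hμ : ∀ x, 0 < μ x) {V : X → ℝ}
    (hV : Admissible b μ V) :
    ∃ (H : Ell2 μ →ₗ.[ℂ] Ell2 μ) (q : QuadForm (Ell2 μ)),
      IsRealizationWithForm b μ V H q ∧ q.FirstBeurlingDeny := by
  classical
  obtain ⟨c, w, hw, hs, hsup⟩ := hV.exists_supersolution hμ
  -- This is `μ (ℋ - c) w / w`, nonnegative exactly by the supersolution inequality.
  set k : X → ℝ := fun x => b.degree x + (V x - c) * μ x -
    (w x)⁻¹ * ∑' y, b.weight x y * w y with hk_def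
  have hk : ∀ x, 0 ≤ k x := fun x => by
    rw [hk_def, sub_nonneg, inv_mul_le_iff₀ (hw x), mul_comm]
    exact hsup x
  set q := QuadForm.ofFunctionals (gradientMap hμ (b.transform w hw hs) w k) c with hq
  have hδ : ∀ x, deltaEll2 μ x ∈ q.domain := fun x => deltaEll2_mem_sqSummableDomain hμ x
  have hform : q.IsFormOf q.toOp := QuadForm.isFormOf_toOp (dense_of_deltaEll2_mem hμ hδ)
    (QuadForm.lowerSemibounded_ofFunctionals _ _)
    (QuadForm.closed_ofFunctionals (continuous_gradientMap hμ) _)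
  refine ⟨q.toOp, q, ⟨hform.isSelfAdjoint, hform.lower_bound, hform,
    mem_of_finite_support_of_deltaEll2_mem hμ hδ, fun f => ?_, fun f x => ?_⟩,
    firstBeurlingDeny_gradientMap hμ hw c⟩
  · obtain ⟨hf, _⟩ := hform.apply_sesq f
    exact mem_formalDomain_of_mem_sqSummableDomain hμ hw hs hf
  · obtain ⟨hf, h1⟩ := hform.apply_sesq f
    have h2 := h1 ⟨_, hδ x⟩
    have h3 := sesq_deltaEll2 hμ hw hs hk (fun x => rfl) ⟨_, hf⟩ x
    rw [inner_deltaEll2 hμ] at h2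
    have h4 := mul_right_cancel₀ (Complex.ofReal_ne_zero.2 (hμ x).ne') (h2.symm.trans h3)
    exact (starRingEnd ℂ).injective h4

end Sufficiency

end DiscreteSchrodinger

theorem mainTheorem3 {X : Type*} [Countable X] [Nonempty X]
    [MeasurableSpace X] [DiscreteMeasurableSpace X]
    (b : DiscreteSchrodinger.WeightedGraph X) (μ : X → ℝ) (hμ : ∀ x, 0 < μ x) (V : X → ℝ) :
    (∃ (H : DiscreteSchrodinger.Ell2 μ →ₗ.[ℂ] DiscreteSchrodinger.Ell2 μ)
        (q : DiscreteSchrodinger.QuadForm (DiscreteSchrodinger.Ell2 μ)),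
        DiscreteSchrodinger.IsRealizationWithForm b μ V H q ∧ q.FirstBeurlingDeny) ↔
      DiscreteSchrodinger.Admissible b μ V := by
  exact ⟨fun ⟨_, _, hR, hBD⟩ => hR.admissible hμ hBD, fun hV => hV.exists_realization hμ⟩
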